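/- **Setting.** Let $\mathcal J_d=\{(j_1,j_2):1\le j_1\le j_2\le d\}$. In the mixture multi-layer Poisson block model (MMPBM) there are $n$ layers on $d$ common vertices, layer labels $z^*\in[2]^n$, community assignments $\sigma_1,\sigma_2:[d]\to[K]$ and symmetric matrices $B_1,B_2\in\mathbb R_+^{K\times K}$; with $P_m(j_1,j_2)=B_m(\sigma_m(j_1),\sigma_m(j_2))$, all weights $X_i(\omega)$, $i\in[n]$, $\omega\in\mathcal J_d$, are independent and $X_i(\omega)\sim\mathrm{Poisson}(P_{z_i^*}(\omega))$. For constants $\alpha,\beta,\gamma\ge1$ and $\theta_0>0$ it is assumed that $|\{i:z_i^*=m\}|\in[\frac n{2\alpha},\frac{\alpha n}2]$, $|\{j:\sigma_m(j)=k\}|\in[\frac d{\beta K},\frac{\beta d}K]$ and $\theta_0\le B_m(k,l)\le\gamma\theta_0$ for all $m,k,l$. Put $I^*=\sum_{\omega\in\mathcal J_d}(\sqrt{P_1(\omega)}-\sqrt{P_2(\omega)})^2$, and for label vectors of length $N$ let $h(a,b)=\min_\pi\frac1N\sum_j\mathbb I(a_j\ne\pi(b_j))$, the minimum over permutations of the labels.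 **Algorithm.** For each $i\in[n]$ a (possibly randomized) initialization algorithm is applied to $\{X_{i'}\}_{i'\ne i}$, its randomization being independent of the data; it returns labels $\tilde z^{(-i)}_{j}\in[2]$, $j\ne i$, and $\tilde\sigma^{(-i)}_1,\tilde\sigma^{(-i)}_2:[d]\to[K]$. Set $\tilde z_i^{(-i)}=0$ (a dummy entry). Let $\hat B^{(-i)}_m(k,l)$ be the average of $X_{i'}(\omega)$ over the $i'\ne i$ with $\tilde z^{(-i)}_{i'}=m$ and the $\omega\in\mathcal J_d$ that join the communities $k$ and $l$ (in either order) of $\tilde\sigma_m^{(-i)}$, and $\hat P_m^{(-i)}(j_1,j_2)=\hat B_m^{(-i)}(\tilde\sigma_m^{(-i)}(j_1),\tilde\sigma_m^{(-i)}(j_2))$. Put $\hat z_j^{(-i)}=\tilde z_j^{(-i)}$ for $j\ne i$ and $$\hat z_i^{(-i)}\in\arg\max_{m\in[2]}\sum_{\omega\in\mathcal J_d}\Big(-\hat P_m^{(-i)}(\omega)+X_i(\omega)\log\hat P_m^{(-i)}(\omega)\Big).$$ The output is $\hat z_1=\hat z_1^{(-1)}$ and, for $i\ge2$, $\hat z_i\in\arg\max_{m\in[2]}|\{j:\hat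 z^{(-1)}_j=m\}\cap\{j:\hat z_j^{(-i)}=\hat z_i^{(-i)}\}|$. Ties are broken arbitrarily. **Theorem.** Let $n,d\to\infty$, where $K$, $\theta_0$, $z^*$, $B_m$, $\sigma_m$, the initialization algorithm and $\eta_z,\eta_\sigma$ may vary along the sequence while $\alpha,\beta,\gamma,C_0,C_1>0$ are fixed. Let $G$ be the event that for every $i\in[n]$ there is a permutation $\pi$ of $[2]$ with $\frac1n\sum_{j=1}^n\mathbb I(\tilde z_j^{(-i)}\ne\pi(z^*_j))\le\eta_z$ and $h(\tilde\sigma^{(-i)}_{\pi(m)},\sigma_m)\le\eta_\sigma$ for $m=1,2$, and suppose that $\mathbb P(G)\ge1-C_1(n\vee d)^{-2}$. Suppose $$\eta_\sigma\log\frac1{\eta_\sigma}=o\Big(\frac{I^{*2}}{K^2d^2\theta_0(d/n)}\Big),\qquad \eta_\sigma\vee\eta_z=o\Big(\frac{I^*}{K^2d^2\theta_0}\Big),$$ $(n\wedge d)\,d\,\theta_0\ge C_0$, $K^2\log n=o(n)$ and $I^*\to\infty$. Then: 1. for every $\epsilon\in(0,1)$, for all large $n,d$, conditionally on $G$, with probability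 at least $1-\exp(-(I^*)^{1-\epsilon})$, $h(\hat z,z^*)\le\exp(-(1-o(1))I^*/2)$; 2. for every constant $C'>0$, $\mathbb E[h(\hat z,z^*)\mid G]\le\exp(-(1-o(1))I^*/2)+O(n^{-C'})$; 3. without conditioning, $\mathbb E\,h(\hat z,z^*)\le\exp(-(1-o(1))I^*/2)+O(n^{-2})$. -/

import Mathlib

open MeasureTheory ProbabilityTheory Filter Asymptotics Topology

namespace MMPBM

/-- Unordered vertex pairs (self-loops allowed): the set of `(j₁, j₂)` with `j₁ ≤ j₂`. -/
abbrev Edge (d : ℕ) : Type := {p : Fin d × Fin d // p.1 ≤ p.2}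

/-- A weighted network on `d` vertices, given by its adjacency weights on `Edge d`. -/
abbrev Network (d : ℕ) : Type := Edge d → ℕ

/-- Parameters: layer labels `z`, intensity matrices `B m`, community assignments `σ m`
(`m : Fin 2` stands for the two layer classes). -/
structure Params (n d K : ℕ) where
  z : Fin n → Fin 2
  B : Fin 2 → Matrix (Fin K) (Fin K) ℝ
  σ : Fin 2 → Fin d → Fin K

/-- The parameter space with intensity level `θ₀` and balance constants `α`, `β`, `γ`. -/
structure Params.InSpace {n d K : ℕ} (p : Params n d K) (θ₀ α β γ : ℝ) : Prop where
  layer_lower : ∀ m, (n : ℝ) / (2 * α) ≤ ((Finset.univ.filter fun i => p.z i = m).card : ℝ)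
  layer_upper : ∀ m, ((Finset.univ.filter fun i => p.z i = m).card : ℝ) ≤ α * n / 2
  node_lower : ∀ m k, (d : ℝ) / (β * K) ≤ ((Finset.univ.filter fun j => p.σ m j = k).card : ℝ)
  node_upper : ∀ m k, ((Finset.univ.filter fun j => p.σ m j = k).card : ℝ) ≤ β * d / K
  symm : ∀ m, (p.B m).IsSymm
  lower : ∀ m k l, θ₀ ≤ p.B m k l
  upper : ∀ m k l, p.B m k l ≤ γ * θ₀

/-- The edge intensity `P_m(ω) = B_m(σ_m(ω))`. -/
def Params.P {n d K : ℕ} (p : Params n d K) (m : Fin 2) (e : Edge d) : ℝ :=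
  p.B m (p.σ m e.1.1) (p.σ m e.1.2)

/-- The signal strength `I* = ∑_ω (√P₁(ω) - √P₂(ω))²`. -/
noncomputable def Params.signal {n d K : ℕ} (p : Params n d K) : ℝ :=
  ∑ e : Edge d, (√(p.P 0 e) - √(p.P 1 e)) ^ 2

/-- The mixture multi-layer Poisson block model: all edge weights of all layers are independent,
and the weight of `e` in layer `i` is Poisson with mean `P_{z_i}(e)`. -/
structure IsMMPBM {Ω : Type*} [MeasurableSpace Ω] {n d K : ℕ} (p : Params n d K)
    (X : Ω → Fin n → Network d) (μ : Measure Ω) : Prop where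
  meas : Measurable X
  indep : iIndepFun (fun (q : Fin n × Edge d) ω => X ω q.1 q.2) μ
  law : ∀ i e, μ.map (fun ω => X ω i e) = poissonMeasure (p.P (p.z i) e).toNNReal

/-- Proportion of misclassified indices when the true labels `z'` are relabelled by `π`. -/
noncomputable def errorUnder {ι L : Type*} [Fintype ι] [DecidableEq L]
    (π : Equiv.Perm L) (z z' : ι → L) : ℝ :=
  ((Finset.univ.filter fun i => z i ≠ π (z' i)).card : ℝ) / Fintype.card ι

/-- The clustering error `h(z, z') = min_π (1/|ι|) ∑_i 1(z_i ≠ π(z'_i))`. -/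
noncomputable def clusterError {ι L : Type*} [Fintype ι] [Fintype L] [DecidableEq L]
    (z z' : ι → L) : ℝ :=
  Finset.univ.inf' ⟨(1 : Equiv.Perm L), Finset.mem_univ _⟩ fun π => errorUnder π z z'

/-- What an initialization run without layer `i` returns: labels of the other layers and the
two community assignments. -/
abbrev InitOutput (n d K : ℕ) (i : Fin n) : Type :=
  ({j : Fin n // j ≠ i} → Fin 2) × (Fin 2 → Fin d → Fin K)

/-- The initial labels as a vector of length `n`, with a dummy entry (`none`) at position `i`. -/
def withDummy {n : ℕ} (i : Fin n) (w : {j : Fin n // j ≠ i} → Fin 2) (j : Fin n) :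
    Option (Fin 2) :=
  if h : j ≠ i then some (w ⟨j, h⟩) else none

/-- The layer labels have error at most `ηz` and the community assignments error at most `ησ`,
under a common identification `π` of the two estimated classes with the two true classes. The
dummy entry counts as an error. -/
def InitAccurate {n d K : ℕ} (p : Params n d K) (ηz ησ : ℝ) (i : Fin n)
    (w : InitOutput n d K i) : Prop :=
  ∃ π : Equiv.Perm (Fin 2),
    ((Finset.univ.filter fun j => withDummy i w.1 j ≠ some (π (p.z j))).card : ℝ) / n ≤ ηz ∧
    ∀ m, clusterError (w.2 (π m)) (p.σ m) ≤ ησ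

/-- The edge `e` joins communities `k` and `l` (in either order). -/
abbrev Joins {d K : ℕ} (s : Fin d → Fin K) (k l : Fin K) (e : Edge d) : Prop :=
  (s e.1.1 = k ∧ s e.1.2 = l) ∨ (s e.1.1 = l ∧ s e.1.2 = k)

/-- The leave-one-out estimate of `B_m(k, l)`: the average weight, over the layers other than `i`
with initial label `m`, of the edges joining the estimated communities `k` and `l`. -/
noncomputable def Bhat {n d K : ℕ} (X : Fin n → Network d) (i : Fin n) (w : InitOutput n d K i)
    (m : Fin 2) (k l : Fin K) : ℝ :=
  (∑ j : {j : Fin n // j ≠ i}, if w.1 j = m then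
      ∑ e : Edge d, if Joins (w.2 m) k l e then (X j e : ℝ) else 0 else 0) /
  (∑ j : {j : Fin n // j ≠ i}, if w.1 j = m then
      ∑ e : Edge d, if Joins (w.2 m) k l e then (1 : ℝ) else 0 else 0)

/-- The leave-one-out estimate of the edge intensity `P_m(ω)`. -/
noncomputable def Phat {n d K : ℕ} (X : Fin n → Network d) (i : Fin n) (w : InitOutput n d K i)
    (m : Fin 2) (e : Edge d) : ℝ :=
  Bhat X i w m (w.2 m e.1.1) (w.2 m e.1.2)

open Classical in
/-- The Poisson log-likelihood `-r + x log r` (up to a term free of `r`), with value `-∞` when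
`r = 0 < x`, and `0` when `r = x = 0`. -/
noncomputable def logLik (r : ℝ) (x : ℕ) : EReal :=
  if r = 0 ∧ x ≠ 0 then ⊥ else ((-r + x * Real.log r : ℝ) : EReal)

/-- The estimated log-likelihood of class `m` for layer `i`. -/
noncomputable def score {n d K : ℕ} (X : Fin n → Network d) (i : Fin n) (w : InitOutput n d K i)
    (m : Fin 2) : EReal :=
  ∑ e : Edge d, logLik (Phat X i w m e) (X i e)

/-- `zhat` is an output of the two-stage algorithm on data `X` with leave-one-out
initializations `w i`. Ties in either maximization may be broken in any way. Here `zloc i` is the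
label vector obtained from the `i`-th run: initial labels off `i`, and a likelihood maximizer at
`i`; the last two clauses align the runs with the first one. -/
def IsTwoStageOutput {n d K : ℕ} (X : Fin n → Network d) (w : ∀ i, InitOutput n d K i)
    (zhat : Fin n → Fin 2) : Prop :=
  ∃ zloc : Fin n → Fin n → Fin 2,
    (∀ i j, ∀ h : j ≠ i, zloc i j = (w i).1 ⟨j, h⟩) ∧
    (∀ i m, score X i (w i) m ≤ score X i (w i) (zloc i i)) ∧
    (∀ i : Fin n, i.val = 0 → zhat i = zloc i i) ∧
    (∀ i : Fin n, i.val ≠ 0 → ∀ m,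
      (Finset.univ.filter fun j =>
        zloc ⟨0, i.pos⟩ j = m ∧ zloc i j = zloc i i).card ≤
      (Finset.univ.filter fun j =>
        zloc ⟨0, i.pos⟩ j = zhat i ∧ zloc i j = zloc i i).card)

/-- An initialization algorithm for each leave-one-out run: a function of a random seed and of
the layers other than `i`. -/
abbrev InitAlgorithm (S : Type*) (n d K : ℕ) : Type _ :=
  ∀ i : Fin n, S → ({j : Fin n // j ≠ i} → Network d) → InitOutput n d K i

/-- Run the initialization on all leave-one-out data sets. -/
def InitAlgorithm.run {S : Type*} {n d K : ℕ} (A : InitAlgorithm S n d K) (s : S)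
    (X : Fin n → Network d) (i : Fin n) : InitOutput n d K i :=
  A i s fun j => X j

end MMPBM

/-!
# Two-stage clustering in the mixture multi-layer Poisson block model

Everything follows from one estimate: on the event `G` that all initializations are accurate, the
expected clustering error is at most `exp (-(1 - ε) I* / 2)` eventually, for every `ε > 0`
(`exists_setIntegral_clusterError_le`). The second part then holds with no additional term, the
third adds the probability of the complement of `G`, and the first is Markov's inequality.

*Alignment.* When the initial labels are accurate, matching the runs to the first one is
error-free, so the clustering error is at most the proportion of layers `i` whose likelihood test
fails (`clusterError_le_card_testFails`). No union bound over the layers is needed.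

*Leave-one-out.* Layer `i` is independent of the other layers together with the seed, hence of the
estimated intensities `P̂`. Given these, the failure probability of the test is bounded by Chernoff's
inequality at `1 / 2`, with exponent
`∑ ((P̂_a - P̂_b) / 2 + P_a (√(P̂_b / P̂_a) - 1))`. This is `-(1 - δ) I* / 2` up to
`O_δ (∑ (P̂ - P)² / θ₀)` (`chernoff_exponent_le`).

*Estimation.* It remains to see `∑ (P̂_m - P_m)² = o(I* θ₀)`, although the initialization depends on
the data from which `P̂` is computed. On the event `NoiseGood`, which is uniform over all accurate
initializations, the block intensities have relative error `O(s + K ησ + ηz)` with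
`s² = κ I* / (d² θ₀)` and `κ` a small constant; the edges with a misclassified endpoint add
`O(ησ d² θ₀²)` (`Phat_bounds`).

*Noise.* The event `NoiseGood` fails with probability at most `exp (-I*)` by a union bound
(`IsMMPBM.measureReal_not_noiseGood_le`, `Regime.noise_le`). The layers of one true class fluctuate
with a sub-Gaussian tail, which beats the entropy `d ησ log (1 / ησ)` of the community assignments.
The weight of the mislabelled layers is treated separately: a sub-exponential tail would lose a
logarithm against their entropy `n ηz log (1 / ηz)`, but the Poisson tail has the same factor
`log (1 / ηz)` in its exponent, as the level exceeds the mean by a factor of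
order at least `ηz ^ (-1 / 2)`.
-/

namespace MMPBM

/-! ### Poisson tails and independence -/

lemma hasSum_exp_mul_poisson (r : NNReal) (c : ℝ) :
    HasSum (fun k : ℕ => Real.exp (-r) * (r : ℝ) ^ k / k.factorial * Real.exp (c * k))
      (Real.exp (r * (Real.exp c - 1))) := by
  have h := (NormedSpace.expSeries_div_hasSum_exp ((r : ℝ) * Real.exp c)).mul_left
    (Real.exp (-r))
  have h₁ : Real.exp (r * (Real.exp c - 1)) =
      Real.exp (-r) * NormedSpace.exp ((r : ℝ) * Real.exp c) := by
    rw [← Real.exp_eq_exp_ℝ, ← Real.exp_add]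
    ring_nf
  have h₂ : (fun k : ℕ => Real.exp (-r) * (r : ℝ) ^ k / k.factorial * Real.exp (c * k)) =
      fun k => Real.exp (-r) * (((r : ℝ) * Real.exp c) ^ k / k.factorial) := by
    ext k
    rw [mul_comm c, Real.exp_nat_mul, mul_pow]
    ring
  rw [h₁, h₂]
  exact h

lemma integrable_exp_mul_poisson (r : NNReal) (c : ℝ) :
    Integrable (fun k : ℕ => Real.exp (c * k)) (poissonMeasure r) := by
  rw [integrable_poissonMeasure_iff]
  simpa only [Real.norm_eq_abs, Real.abs_exp] using (hasSum_exp_mul_poisson r c).summable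

lemma integral_exp_mul_poisson (r : NNReal) (c : ℝ) :
    ∫ k : ℕ, Real.exp (c * k) ∂(poissonMeasure r) = Real.exp (r * (Real.exp c - 1)) := by
  rw [integral_poissonMeasure]
  exact (hasSum_exp_mul_poisson r c).tsum_eq

/-- Chernoff's bound for a linear combination of independent Poisson variables. -/
lemma measureReal_le_sum_poisson_le {Ω ι : Type*} [MeasurableSpace Ω] [Fintype ι]
    {μ : Measure Ω} [IsProbabilityMeasure μ] {Y : ι → Ω → ℕ} {r : ι → ℝ} (hr : ∀ q, 0 ≤ r q)
    (hmeas : ∀ q, Measurable (Y q)) (hind : iIndepFun Y μ)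
    (hlaw : ∀ q, μ.map (Y q) = poissonMeasure (r q).toNNReal) (c : ι → ℝ) (a : ℝ) :
    μ.real {ω | a ≤ ∑ q, c q * (Y q ω : ℝ)} ≤
      Real.exp (-a + ∑ q, r q * (Real.exp (c q) - 1)) := by
  set Z : ι → Ω → ℝ := fun q ω => c q * (Y q ω : ℝ) with hZ
  have hZm : ∀ q, Measurable (Z q) := fun q => by
    have := hmeas q
    fun_prop
  have hZi : iIndepFun Z μ :=
    hind.comp (fun q (k : ℕ) => c q * (k : ℝ)) fun q => measurable_of_countable _
  have hint : ∀ q, Integrable (fun ω => Real.exp (1 * Z q ω)) μ := fun q => by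
    have h := integrable_exp_mul_poisson (r q).toNNReal (c q)
    rw [← hlaw q] at h
    simpa [hZ, Function.comp_def] using h.comp_measurable (hmeas q)
  have hmgf : ∀ q, mgf (Z q) μ 1 = Real.exp (r q * (Real.exp (c q) - 1)) := fun q => by
    have h := integral_exp_mul_poisson (r q).toNNReal (c q)
    rw [← hlaw q, integral_map (hmeas q).aemeasurable
      (measurable_of_countable _).aestronglyMeasurable, Real.coe_toNNReal _ (hr q)] at h
    simpa [mgf, hZ] using h
  have hsum := hZi.integrable_exp_mul_sum hZm (s := Finset.univ) (t := 1) fun q _ => hint q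
  have h := measure_ge_le_exp_mul_mgf (μ := μ) (X := ∑ q, Z q) a zero_le_one hsum
  rw [hZi.mgf_sum hZm, Finset.prod_congr rfl fun q _ => hmgf q, ← Real.exp_sum,
    ← Real.exp_add] at h
  simpa [hZ, Finset.sum_apply] using h

/-- If `X` is independent of `R` and, given `R = r ∈ H`, the event `(X, R) ∈ M` has probability at
most `b`, then so has the joint event. -/
lemma measure_le_of_indepFun {Ω α β : Type*} [MeasurableSpace Ω] [MeasurableSpace α]
    [MeasurableSpace β] {μ : Measure Ω} [IsProbabilityMeasure μ] {X : Ω → α} {R : Ω → β}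
    (hX : Measurable X) (hR : Measurable R) (hXR : IndepFun X R μ) {M : Set (α × β)}
    (hM : MeasurableSet M) {b : ENNReal} (hb : ∀ r, μ {ω | (X ω, r) ∈ M} ≤ b) :
    μ {ω | (X ω, R ω) ∈ M} ≤ b := by
  have hprod := (indepFun_iff_map_prod_eq_prod_map_map hX.aemeasurable hR.aemeasurable).1 hXR
  have : IsProbabilityMeasure (μ.map R) := Measure.isProbabilityMeasure_map hR.aemeasurable
  calc μ {ω | (X ω, R ω) ∈ M} = (μ.map fun ω => (X ω, R ω)) M :=
        (Measure.map_apply (hX.prodMk hR) hM).symm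
    _ = ∫⁻ r, (μ.map X) ((fun x => (x, r)) ⁻¹' M) ∂(μ.map R) := by
        rw [hprod, Measure.prod_apply_symm hM]
    _ ≤ ∫⁻ _, b ∂(μ.map R) := by
        refine lintegral_mono fun r => ?_
        rw [Measure.map_apply hX (measurable_prodMk_right hM)]
        exact hb r
    _ = b := by simp

/-- If `U` is independent of `(X, Y)` and `X` of `Y`, then `X` is independent of `(U, Y)`. -/
lemma indepFun_prodMk_of_indepFun {Ω α β υ : Type*} [MeasurableSpace Ω] [MeasurableSpace α]
    [MeasurableSpace β] [MeasurableSpace υ] {μ : Measure Ω} [IsProbabilityMeasure μ]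
    {X : Ω → α} {Y : Ω → β} {U : Ω → υ} (hX : Measurable X) (hY : Measurable Y)
    (hU : Measurable U) (hUXY : IndepFun U (fun ω => (X ω, Y ω)) μ) (hXY : IndepFun X Y μ) :
    IndepFun X (fun ω => (U ω, Y ω)) μ := by
  have : IsProbabilityMeasure (μ.map X) := Measure.isProbabilityMeasure_map hX.aemeasurable
  have : IsProbabilityMeasure (μ.map Y) := Measure.isProbabilityMeasure_map hY.aemeasurable
  have : IsProbabilityMeasure (μ.map U) := Measure.isProbabilityMeasure_map hU.aemeasurable
  have hUY : IndepFun U Y μ := hUXY.comp measurable_id measurable_snd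
  rw [indepFun_iff_map_prod_eq_prod_map_map (by fun_prop) (by fun_prop)] at hUXY hXY hUY ⊢
  rw [hXY] at hUXY
  rw [hUY]
  have hpres := ((measurePreserving_prodAssoc (μ.map X) (μ.map U) (μ.map Y)).comp
    ((Measure.measurePreserving_swap (μ := μ.map U) (ν := μ.map X)).prod
      (MeasurePreserving.id (μ.map Y)))).comp
    (measurePreserving_prodAssoc (μ.map U) (μ.map X) (μ.map Y)).symm
  rw [← hpres.map_eq, ← hUXY, Measure.map_map hpres.measurable (by fun_prop)]
  rfl

/-! ### Hamming balls and block sizes -/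

/-- The indices at which two labellings disagree. -/
def disagree {ι L : Type*} [Fintype ι] [DecidableEq L] (s s₀ : ι → L) : Finset ι :=
  Finset.univ.filter fun j => s j ≠ s₀ j

lemma mem_disagree {ι L : Type*} [Fintype ι] [DecidableEq L] {s s₀ : ι → L} {j : ι} :
    j ∈ disagree s s₀ ↔ s j ≠ s₀ j := by
  simp [disagree]

/-- The generating function of the Hamming distance bounds the size of a Hamming ball. -/
lemma card_hammingBall_le_of_pos {ι L : Type*} [Fintype ι] [DecidableEq ι] [Fintype L]
    [DecidableEq L] (s₀ : ι → L) (R : ℝ) {x : ℝ} (hx : 0 < x) (hx1 : x ≤ 1) :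
    ((Finset.univ.filter fun s : ι → L => ((disagree s s₀).card : ℝ) ≤ R).card : ℝ) ≤
      Real.exp (R * Real.log (1 / x) + Fintype.card ι * (Fintype.card L * x)) := by
  have hlog : 0 ≤ Real.log (1 / x) := Real.log_nonneg (by rw [le_div_iff₀ hx]; linarith)
  have hgen : ∑ s : ι → L, x ^ (disagree s s₀).card ≤
      Real.exp (Fintype.card ι * (Fintype.card L * x)) := by
    have h1 : ∀ s : ι → L, x ^ (disagree s s₀).card =
        ∏ j, (if s j = s₀ j then 1 else x) := fun s => by
      rw [← Finset.prod_const, disagree, Finset.prod_filter]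
      exact Finset.prod_congr rfl fun j _ => by by_cases h : s j = s₀ j <;> simp [h]
    have h2 := Finset.prod_univ_sum (fun _ : ι => (Finset.univ : Finset L))
      (fun j l => if l = s₀ j then (1 : ℝ) else x)
    rw [Fintype.piFinset_univ] at h2
    rw [Finset.sum_congr rfl fun s _ => h1 s, ← h2, Real.exp_nat_mul]
    calc ∏ j, ∑ l, (if l = s₀ j then (1 : ℝ) else x)
        ≤ ∏ _j : ι, Real.exp (Fintype.card L * x) := by
          refine Finset.prod_le_prod (fun j _ => Finset.sum_nonneg fun l _ => ?_) fun j _ => ?_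
          · split_ifs <;> linarith
          · calc ∑ l, (if l = s₀ j then (1 : ℝ) else x)
                ≤ ∑ l, ((if l = s₀ j then (1 : ℝ) else 0) + x) :=
                  Finset.sum_le_sum fun l _ => by split_ifs <;> linarith
              _ = Fintype.card L * x + 1 := by
                  rw [Finset.sum_add_distrib]
                  simp
                  ring
              _ ≤ _ := Real.add_one_le_exp _
      _ = _ := by simp
  have hball : ((Finset.univ.filter fun s : ι → L => ((disagree s s₀).card : ℝ) ≤ R).card : ℝ) *
      Real.exp (-(R * Real.log (1 / x))) ≤ ∑ s : ι → L, x ^ (disagree s s₀).card := by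
    rw [← nsmul_eq_mul]
    refine (Finset.card_nsmul_le_sum _ _ _ fun s hs => ?_).trans
      (Finset.sum_le_sum_of_subset_of_nonneg (Finset.filter_subset _ _) fun s _ _ => by positivity)
    have hs' : ((disagree s s₀).card : ℝ) ≤ R := (Finset.mem_filter.1 hs).2
    rw [← Real.exp_log (pow_pos hx _), Real.log_pow]
    refine Real.exp_le_exp.2 ?_
    rw [one_div, Real.log_inv] at hlog ⊢
    nlinarith
  rw [Real.exp_add]
  rw [Real.exp_neg, ← div_eq_mul_inv, div_le_iff₀ (Real.exp_pos _)] at hball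
  calc _ ≤ _ := hball
    _ ≤ _ := by
      rw [mul_comm]
      gcongr

/-- A Hamming ball of relative radius `η` has at most `exp (2 η log (1 / η) · |ι|)` elements when
the number of labels is at most `η ^ (-1 / 2)`. The bound also holds for `η = 0`. -/
lemma card_hammingBall_le {ι L : Type*} [Fintype ι] [DecidableEq ι] [Fintype L] [Nonempty L]
    [DecidableEq L] (s₀ : ι → L) {η : ℝ} (hη : 0 ≤ η) (hL : (Fintype.card L : ℝ) ^ 2 * η ≤ 1)
    (hη2 : η ≤ Real.exp (-2)) :
    ((Finset.univ.filter fun s : ι → L =>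
        ((disagree s s₀).card : ℝ) ≤ η * Fintype.card ι).card : ℝ) ≤
      Real.exp (2 * (Fintype.card ι * (η * Real.log (1 / η)))) := by
  have hK : (0 : ℝ) < Fintype.card L := by exact_mod_cast Fintype.card_pos
  have hK1 : (1 : ℝ) ≤ Fintype.card L := by exact_mod_cast Fintype.card_pos
  rcases hη.eq_or_lt with rfl | hη
  · have h : (Finset.univ.filter fun s : ι → L =>
        ((disagree s s₀).card : ℝ) ≤ 0 * Fintype.card ι) ⊆ {s₀} := fun s hs => by
      have h0 : ((disagree s s₀).card : ℝ) ≤ 0 := by simpa using hs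
      have h1 : disagree s s₀ = ∅ :=
        Finset.card_eq_zero.1 (by exact_mod_cast le_antisymm h0 (by positivity))
      rw [Finset.mem_singleton]
      ext j
      by_contra hj
      have := mem_disagree.2 hj
      simp [h1] at this
    have := Finset.card_le_card h
    simpa using this
  · have hx : 0 < η / Fintype.card L := by positivity
    have hη1 : η ≤ 1 := hη2.trans (by rw [Real.exp_le_one_iff]; norm_num)
    have hx1 : η / Fintype.card L ≤ 1 := by
      rw [div_le_one hK]
      linarith
    refine (card_hammingBall_le_of_pos s₀ _ hx hx1).trans (Real.exp_le_exp.2 ?_)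
    have hlog2 : 2 ≤ Real.log (1 / η) := by
      rw [one_div, Real.log_inv]
      have := Real.log_le_log hη hη2
      rw [Real.log_exp] at this
      linarith
    have hlogK : 2 * Real.log (Fintype.card L) ≤ Real.log (1 / η) := by
      have h : (Fintype.card L : ℝ) ^ 2 ≤ 1 / η := by rwa [le_div_iff₀ hη]
      have := Real.log_le_log (by positivity) h
      rwa [Real.log_pow] at this
    have h1 : Real.log (1 / (η / Fintype.card L)) =
        Real.log (1 / η) + Real.log (Fintype.card L) := by
      rw [one_div_div, div_eq_mul_one_div, Real.log_mul hK.ne' (by positivity), add_comm]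
    rw [h1, mul_div_cancel₀ _ hK.ne']
    have hc : (0 : ℝ) ≤ Fintype.card ι * η := by positivity
    nlinarith

/-- The edges joining communities `k` and `l`. -/
def blockEdges {d K : ℕ} (s : Fin d → Fin K) (k l : Fin K) : Finset (Edge d) :=
  Finset.univ.filter fun e => Joins s k l e

lemma mem_blockEdges {d K : ℕ} {s : Fin d → Fin K} {k l : Fin K} {e : Edge d} :
    e ∈ blockEdges s k l ↔ Joins s k l e := by
  simp [blockEdges]

/-- The vertices of community `k`. -/
def community {d K : ℕ} (s : Fin d → Fin K) (k : Fin K) : Finset (Fin d) :=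
  Finset.univ.filter fun j => s j = k

lemma mem_community {d K : ℕ} {s : Fin d → Fin K} {k : Fin K} {j : Fin d} :
    j ∈ community s k ↔ s j = k := by
  simp [community]

lemma card_edge_le (d : ℕ) : Fintype.card (Edge d) ≤ d ^ 2 := by
  refine (Fintype.card_subtype_le _).trans ?_
  simp [sq]

lemma card_community_mul_le {d K : ℕ} (s : Fin d → Fin K) (k l : Fin K) :
    (community s k).card * (community s l).card ≤ 2 * (blockEdges s k l).card := by
  have h : community s k ×ˢ community s l ⊆
      (blockEdges s k l).image (fun e => e.1) ∪ (blockEdges s k l).image fun e => e.1.swap := by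
    rintro ⟨u, v⟩ huv
    rw [Finset.mem_product, mem_community, mem_community] at huv
    rw [Finset.mem_union, Finset.mem_image, Finset.mem_image]
    rcases le_total u v with h | h
    · exact Or.inl ⟨⟨(u, v), h⟩, mem_blockEdges.2 (Or.inl huv), rfl⟩
    · exact Or.inr ⟨⟨(v, u), h⟩, mem_blockEdges.2 (Or.inr huv.symm), rfl⟩
  rw [← Finset.card_product, two_mul]
  exact (Finset.card_le_card h).trans ((Finset.card_union_le _ _).trans
    (Nat.add_le_add Finset.card_image_le Finset.card_image_le))

lemma card_blockEdges_le {d K : ℕ} (s : Fin d → Fin K) (k l : Fin K) :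
    (blockEdges s k l).card ≤ 2 * ((community s k).card * (community s l).card) := by
  rw [← Finset.card_image_of_injective (blockEdges s k l) Subtype.val_injective]
  have h : (blockEdges s k l).image Subtype.val ⊆
      (community s k ×ˢ community s l) ∪ (community s l ×ˢ community s k) := by
    intro x hx
    obtain ⟨e, he, rfl⟩ := Finset.mem_image.1 hx
    simpa [mem_community] using mem_blockEdges.1 he
  refine (Finset.card_le_card h).trans ((Finset.card_union_le _ _).trans ?_)
  rw [Finset.card_product, Finset.card_product, mul_comm (community s l).card]
  omega

/-- The edges with an endpoint at which the labellings `s` and `s₀` disagree. -/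
def wrongEdges {d K : ℕ} (s s₀ : Fin d → Fin K) : Finset (Edge d) :=
  Finset.univ.filter fun e => e.1.1 ∈ disagree s s₀ ∨ e.1.2 ∈ disagree s s₀

lemma card_wrongEdges_le {d K : ℕ} (s s₀ : Fin d → Fin K) :
    (wrongEdges s s₀).card ≤ 2 * ((disagree s s₀).card * d) := by
  rw [← Finset.card_image_of_injective (wrongEdges s s₀) Subtype.val_injective]
  have h : (wrongEdges s s₀).image Subtype.val ⊆
      (disagree s s₀ ×ˢ Finset.univ) ∪ (Finset.univ ×ˢ disagree s s₀) := by
    intro x hx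
    obtain ⟨e, he, rfl⟩ := Finset.mem_image.1 hx
    simpa [wrongEdges] using he
  refine (Finset.card_le_card h).trans ((Finset.card_union_le _ _).trans ?_)
  simp only [Finset.card_product, Finset.card_univ, Fintype.card_fin]
  rw [mul_comm d]
  omega

lemma card_blockEdges_inter_wrongEdges_le {d K : ℕ} (s s₀ : Fin d → Fin K) (k l : Fin K) :
    (blockEdges s k l ∩ wrongEdges s s₀).card ≤
      2 * ((disagree s s₀).card * ((community s k).card + (community s l).card)) := by
  rw [← Finset.card_image_of_injective (blockEdges s k l ∩ wrongEdges s s₀)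
    Subtype.val_injective]
  have h : (blockEdges s k l ∩ wrongEdges s s₀).image Subtype.val ⊆
      (disagree s s₀ ×ˢ (community s k ∪ community s l)) ∪
        ((community s k ∪ community s l) ×ˢ disagree s s₀) := by
    intro x hx
    obtain ⟨e, he, rfl⟩ := Finset.mem_image.1 hx
    rw [Finset.mem_inter, mem_blockEdges] at he
    obtain ⟨he1, he2⟩ := he
    simp only [wrongEdges, Finset.mem_filter, Finset.mem_univ, true_and] at he2
    simp only [Finset.mem_union, Finset.mem_product, mem_community]
    rcases he1 with h | h <;> rcases he2 with h' | h' <;> simp [h, h']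
  refine (Finset.card_le_card h).trans ((Finset.card_union_le _ _).trans ?_)
  have hu := Finset.card_union_le (community s k) (community s l)
  have hu' := Nat.mul_le_mul_left (disagree s s₀).card hu
  simp only [Finset.card_product]
  rw [mul_comm (community s k ∪ community s l).card]
  omega

/-- Off the wrong edges, the intensity of an edge of an estimated block is the block intensity. -/
lemma Params.P_eq_of_mem_blockEdges {n d K : ℕ} (p : Params n d K) {m : Fin 2}
    (hs : (p.B m).IsSymm) {s : Fin d → Fin K} {k l : Fin K} {e : Edge d}
    (he : e ∈ blockEdges s k l) (hw : e ∉ wrongEdges s (p.σ m)) : p.P m e = p.B m k l := by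
  simp only [wrongEdges, mem_disagree, Finset.mem_filter, Finset.mem_univ, true_and, not_or,
    not_not] at hw
  rw [Params.P, ← hw.1, ← hw.2]
  rcases mem_blockEdges.1 he with h | h
  · rw [h.1, h.2]
  · rw [h.1, h.2, hs.apply]

lemma Params.InSpace.P_lower {n d K : ℕ} {p : Params n d K} {θ₀ α β γ : ℝ}
    (hp : p.InSpace θ₀ α β γ) (m : Fin 2) (e : Edge d) : θ₀ ≤ p.P m e :=
  hp.lower _ _ _

lemma Params.InSpace.P_upper {n d K : ℕ} {p : Params n d K} {θ₀ α β γ : ℝ}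
    (hp : p.InSpace θ₀ α β γ) (m : Fin 2) (e : Edge d) : p.P m e ≤ γ * θ₀ :=
  hp.upper _ _ _

/-- The signal is at most of the order of the expected total weight of a layer. -/
lemma Params.InSpace.signal_le {n d K : ℕ} {p : Params n d K} {θ₀ α β γ : ℝ}
    (hp : p.InSpace θ₀ α β γ) (hθ : 0 < θ₀) (hγ : 1 ≤ γ) :
    p.signal ≤ γ * ((d : ℝ) ^ 2 * θ₀) := by
  have hterm : ∀ e : Edge d, (√(p.P 0 e) - √(p.P 1 e)) ^ 2 ≤ γ * θ₀ := fun e => by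
    have h0 := hθ.le.trans (hp.P_lower 0 e)
    have h1 := hθ.le.trans (hp.P_lower 1 e)
    have hs0 := Real.sq_sqrt h0
    have hs1 := Real.sq_sqrt h1
    have hn0 := Real.sqrt_nonneg (p.P 0 e)
    have hn1 := Real.sqrt_nonneg (p.P 1 e)
    have hu0 := hp.P_upper 0 e
    have hu1 := hp.P_upper 1 e
    rcases le_total √(p.P 0 e) √(p.P 1 e) with h | h <;> nlinarith
  calc p.signal ≤ ∑ _e : Edge d, γ * θ₀ := Finset.sum_le_sum fun e _ => hterm e
    _ = Fintype.card (Edge d) * (γ * θ₀) := by simp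
    _ ≤ (d : ℝ) ^ 2 * (γ * θ₀) := by
        have : (Fintype.card (Edge d) : ℝ) ≤ (d : ℝ) ^ 2 := by exact_mod_cast card_edge_le d
        have : 0 ≤ γ * θ₀ := by positivity
        gcongr
    _ = _ := by ring

/-! ### Estimated intensities on the noise event -/

lemma abs_sum_sub_sum_le {ι : Type*} [DecidableEq ι] {J J' D : Finset ι} (hJ : J \ J' ⊆ D)
    (hJ' : J' \ J ⊆ D) {F : ι → ℝ} (hF : ∀ j, 0 ≤ F j) :
    |∑ j ∈ J', F j - ∑ j ∈ J, F j| ≤ ∑ j ∈ D, F j := by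
  rw [← Finset.sum_sdiff_sub_sum_sdiff]
  have h1 := Finset.sum_le_sum_of_subset_of_nonneg hJ fun j _ _ => hF j
  have h2 := Finset.sum_le_sum_of_subset_of_nonneg hJ' fun j _ _ => hF j
  have h3 : 0 ≤ ∑ j ∈ J \ J', F j := Finset.sum_nonneg fun j _ => hF j
  have h4 : 0 ≤ ∑ j ∈ J' \ J, F j := Finset.sum_nonneg fun j _ => hF j
  rw [abs_le]
  constructor <;> linarith

/-- Comparison of a block sum over an estimated set `J'` of layers with its ideal value
`|J'| |E| B`: besides the noise `u` of the true layers `J` and the weight `u` of the mislabelled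
layers `D`, there is the bias due to the wrong edges `W` and to the wrong number of layers. -/
lemma abs_blockSum_sub_le {ι κ : Type*} [DecidableEq ι] [DecidableEq κ] {x : ι → κ → ℝ}
    (hx : ∀ j e, 0 ≤ x j e) {P : κ → ℝ} {B b u : ℝ} {J J' D : Finset ι} {E W : Finset κ}
    (hJ : J \ J' ⊆ D) (hJ' : J' \ J ⊆ D) (hP : ∀ e ∈ E, e ∉ W → P e = B)
    (hPB : ∀ e, |P e - B| ≤ b) (hB0 : 0 ≤ B) (hBb : B ≤ b)
    (h1 : |∑ j ∈ J, ∑ e ∈ E, (x j e - P e)| ≤ u) (h2 : ∑ j ∈ D, ∑ e ∈ E, x j e ≤ u) :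
    |∑ j ∈ J', ∑ e ∈ E, x j e - J'.card * E.card * B| ≤
      2 * u + J.card * (E ∩ W).card * b + D.card * E.card * b := by
  have hb : 0 ≤ b := hB0.trans hBb
  have e1 := (abs_sum_sub_sum_le hJ hJ' (F := fun j => ∑ e ∈ E, x j e)
    fun j => Finset.sum_nonneg fun e _ => hx j e).trans h2
  have e2 := abs_sum_sub_sum_le hJ hJ' (F := fun _ => (1 : ℝ)) fun _ => zero_le_one
  simp only [Finset.sum_const, nsmul_eq_mul, mul_one] at e2
  have e3 : |∑ e ∈ E, (P e - B)| ≤ (E ∩ W).card * b := by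
    have h : ∑ e ∈ E, (P e - B) = ∑ e ∈ E ∩ W, (P e - B) := by
      refine (Finset.sum_subset Finset.inter_subset_left fun e he hn => ?_).symm
      rw [hP e he fun hw => hn (Finset.mem_inter.2 ⟨he, hw⟩), sub_self]
    rw [h]
    refine (Finset.abs_sum_le_sum_abs _ _).trans ?_
    rw [← nsmul_eq_mul]
    exact Finset.sum_le_card_nsmul _ _ _ fun e _ => hPB e
  have e4 : |(J.card : ℝ) * ∑ e ∈ E, (P e - B)| ≤ J.card * (E ∩ W).card * b := by
    rw [abs_mul, Nat.abs_cast, mul_assoc]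
    gcongr
  have e5 : |((J'.card : ℝ) - J.card) * (E.card * B)| ≤ D.card * E.card * b := by
    rw [abs_mul, mul_assoc, abs_of_nonneg (a := (E.card : ℝ) * B) (by positivity)]
    gcongr
  have key : ∑ j ∈ J', ∑ e ∈ E, x j e - J'.card * E.card * B =
      (∑ j ∈ J', ∑ e ∈ E, x j e - ∑ j ∈ J, ∑ e ∈ E, x j e) +
        ∑ j ∈ J, ∑ e ∈ E, (x j e - P e) + J.card * ∑ e ∈ E, (P e - B) -
        ((J'.card : ℝ) - J.card) * (E.card * B) := by
    simp only [Finset.sum_sub_distrib, Finset.sum_const, nsmul_eq_mul]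
    ring
  rw [key]
  rw [abs_le] at *
  constructor <;> linarith [e1.1, e1.2, h1.1, h1.2, e4.1, e4.2, e5.1, e5.2]

/-- The layers other than `i` of true class `m`. -/
def otherLayers {n d K : ℕ} (p : Params n d K) (i : Fin n) (m : Fin 2) : Finset (Fin n) :=
  Finset.univ.filter fun j => j ≠ i ∧ p.z j = m

/-- The layers other than `i` with initial label `m`. -/
def estLayers {n d K : ℕ} {i : Fin n} (w : InitOutput n d K i) (m : Fin 2) : Finset (Fin n) :=
  Finset.univ.filter fun j => withDummy i w.1 j = some m

/-- The data without layer `i` have small fluctuations, uniformly over the community assignments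
within `ησ` of the truth and over the sets of at most `ηz n` layers. -/
structure NoiseGood {n d K : ℕ} (p : Params n d K) (ησ ηz u : ℝ) (i : Fin n)
    (X : Fin n → Network d) : Prop where
  dev : ∀ m s, ((disagree s (p.σ m)).card : ℝ) ≤ ησ * d → ∀ k l,
    |∑ j ∈ otherLayers p i m, ∑ e ∈ blockEdges s k l, ((X j e : ℝ) - p.P m e)| ≤ u
  small : ∀ m s, ((disagree s (p.σ m)).card : ℝ) ≤ ησ * d → ∀ D : Finset (Fin n), i ∉ D →
    (D.card : ℝ) ≤ ηz * n → ∀ k l, ∑ j ∈ D, ∑ e ∈ blockEdges s k l, (X j e : ℝ) ≤ u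

lemma NoiseGood.congr {n d K : ℕ} {p : Params n d K} {ησ ηz u : ℝ} {i : Fin n}
    {X X' : Fin n → Network d} (h : NoiseGood p ησ ηz u i X) (hX : ∀ j, j ≠ i → X j = X' j) :
    NoiseGood p ησ ηz u i X' := by
  constructor
  · intro m s hs k l
    have h1 := h.dev m s hs k l
    rwa [Finset.sum_congr rfl fun j hj => by rw [hX j (Finset.mem_filter.1 hj).2.1]] at h1
  · intro m s hs D hi hD k l
    have h1 := h.small m s hs D hi hD k l
    rwa [Finset.sum_congr rfl fun j hj => by rw [hX j fun hji => hi (hji ▸ hj)]] at h1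

lemma Bhat_eq {n d K : ℕ} (X : Fin n → Network d) (i : Fin n) (w : InitOutput n d K i)
    (m : Fin 2) (k l : Fin K) :
    Bhat X i w m k l = (∑ j ∈ estLayers w m, ∑ e ∈ blockEdges (w.2 m) k l, (X j e : ℝ)) /
      ((estLayers w m).card * (blockEdges (w.2 m) k l).card) := by
  have hsum : ∀ F : Fin n → ℝ, (∑ j : {j : Fin n // j ≠ i}, if w.1 j = m then F j else 0) =
      ∑ j ∈ estLayers w m, F j := fun F => by
    rw [estLayers, Finset.sum_filter, ← Fintype.sum_subtype_add_sum_subtype (fun j => j ≠ i)]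
    have h0 : ∑ j : {j : Fin n // ¬ j ≠ i},
        (if withDummy i w.1 j = some m then F j else 0) = 0 :=
      Finset.sum_eq_zero fun j _ => by simp [withDummy, not_not.1 j.2]
    rw [h0, add_zero]
    refine Finset.sum_congr rfl fun j _ => ?_
    simp [withDummy, j.2]
  have hblock : ∀ F : Edge d → ℝ, (∑ e, if Joins (w.2 m) k l e then F e else 0) =
      ∑ e ∈ blockEdges (w.2 m) k l, F e := fun F => (Finset.sum_filter _ _).symm
  simp only [Bhat, hblock]
  rw [hsum fun j => ∑ e ∈ blockEdges (w.2 m) k l, (X j e : ℝ),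
    hsum fun j => ∑ e ∈ blockEdges (w.2 m) k l, (1 : ℝ)]
  simp

lemma Phat_congr {n d K : ℕ} {X X' : Fin n → Network d} {i : Fin n} (w : InitOutput n d K i)
    (hX : ∀ j, j ≠ i → X j = X' j) (m : Fin 2) (e : Edge d) :
    Phat X i w m e = Phat X' i w m e := by
  simp only [Phat, Bhat]
  congr 1
  refine Finset.sum_congr rfl fun j _ => ?_
  rw [hX j j.2]

lemma card_community_bounds {n d K : ℕ} {p : Params n d K} {θ₀ α β γ ησ : ℝ}
    (hp : p.InSpace θ₀ α β γ) (hβ : 1 ≤ β) (hK : 0 < K) (hη : 2 * β * (K * ησ) ≤ 1) {m : Fin 2}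
    {s : Fin d → Fin K} (hs : ((disagree s (p.σ m)).card : ℝ) ≤ ησ * d) (k : Fin K) :
    (d : ℝ) / (2 * β * K) ≤ (community s k).card ∧
      ((community s k).card : ℝ) ≤ 2 * β * d / K := by
  have hK' : (0 : ℝ) < K := by exact_mod_cast hK
  have hlow := hp.node_lower m k
  have hup := hp.node_upper m k
  change _ ≤ ((community (p.σ m) k).card : ℝ) at hlow
  change ((community (p.σ m) k).card : ℝ) ≤ _ at hup
  have h1 : (community (p.σ m) k).card ≤ (community s k).card + (disagree s (p.σ m)).card := by
    refine le_trans (Finset.card_le_card fun j hj => ?_) (Finset.card_union_le _ _)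
    rw [Finset.mem_union, mem_community, mem_disagree]
    rw [mem_community] at hj
    rw [hj]
    tauto
  have h2 : (community s k).card ≤ (community (p.σ m) k).card + (disagree s (p.σ m)).card := by
    refine le_trans (Finset.card_le_card fun j hj => ?_) (Finset.card_union_le _ _)
    rw [Finset.mem_union, mem_community, mem_disagree]
    rw [mem_community] at hj
    rw [hj]
    rcases eq_or_ne (p.σ m j) k with h | h
    · exact Or.inl h
    · exact Or.inr h.symm
  have h1' : ((community (p.σ m) k).card : ℝ) ≤
    (community s k).card + (disagree s (p.σ m)).card := by exact_mod_cast h1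
  have h2' : ((community s k).card : ℝ) ≤
    (community (p.σ m) k).card + (disagree s (p.σ m)).card := by exact_mod_cast h2
  have hsmall : ησ * d ≤ d / (2 * β * K) := by
    rw [le_div_iff₀ (by positivity)]
    have : (0 : ℝ) ≤ d := by positivity
    nlinarith
  have hhalf : (d : ℝ) / (β * K) = 2 * (d / (2 * β * K)) := by
    field_simp
  have hbig : (d : ℝ) / (2 * β * K) ≤ β * d / K := by
    rw [div_le_div_iff₀ (by positivity) hK']
    have h : (0 : ℝ) ≤ d * K := by positivity
    have hββ : 1 ≤ β * β := by nlinarith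
    nlinarith [mul_le_mul_of_nonneg_right hββ h]
  have hdbl : 2 * β * d / K = 2 * (β * d / K) := by ring
  constructor <;> linarith

/-- The size of an estimated block is of the order `(d / K) ^ 2`. -/
lemma card_blockEdges_bounds {n d K : ℕ} {p : Params n d K} {θ₀ α β γ ησ : ℝ}
    (hp : p.InSpace θ₀ α β γ) (hβ : 1 ≤ β) (hK : 0 < K) (hη : 2 * β * (K * ησ) ≤ 1) {m : Fin 2}
    {s : Fin d → Fin K} (hs : ((disagree s (p.σ m)).card : ℝ) ≤ ησ * d) (k l : Fin K) :
    (d : ℝ) ^ 2 / (8 * β ^ 2 * K ^ 2) ≤ (blockEdges s k l).card ∧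
      ((blockEdges s k l).card : ℝ) ≤ 8 * β ^ 2 * d ^ 2 / K ^ 2 ∧
      ((blockEdges s k l ∩ wrongEdges s (p.σ m)).card : ℝ) ≤ 8 * β * ησ * d ^ 2 / K := by
  have hK' : (0 : ℝ) < K := by exact_mod_cast hK
  obtain ⟨hk1, hk2⟩ := card_community_bounds hp hβ hK hη hs k
  obtain ⟨hl1, hl2⟩ := card_community_bounds hp hβ hK hη hs l
  have h1 : ((community s k).card : ℝ) * (community s l).card ≤ 2 * (blockEdges s k l).card := by
    exact_mod_cast card_community_mul_le s k l
  have h2 : ((blockEdges s k l).card : ℝ) ≤ 2 * ((community s k).card * (community s l).card) := by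
    exact_mod_cast card_blockEdges_le s k l
  have h3 : ((blockEdges s k l ∩ wrongEdges s (p.σ m)).card : ℝ) ≤
      2 * ((disagree s (p.σ m)).card * ((community s k).card + (community s l).card)) := by
    exact_mod_cast card_blockEdges_inter_wrongEdges_le s (p.σ m) k l
  refine ⟨?_, ?_, ?_⟩
  · have h := (mul_le_mul hk1 hl1 (by positivity) (by positivity)).trans h1
    have e : (d : ℝ) / (2 * β * K) * (d / (2 * β * K)) = 2 * (d ^ 2 / (8 * β ^ 2 * K ^ 2)) := by
      field_simp
      norm_num
    linarith
  · have h := mul_le_mul hk2 hl2 (by positivity) (by positivity)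
    have e : 2 * β * d / K * (2 * β * d / K) = (8 * β ^ 2 * d ^ 2 / K ^ 2) / 2 := by
      ring
    linarith
  · have h := mul_le_mul hs (add_le_add hk2 hl2) (by positivity)
      ((by positivity : (0 : ℝ) ≤ _).trans hs)
    have e : ησ * d * (2 * β * d / K + 2 * β * d / K) = (8 * β * ησ * d ^ 2 / K) / 2 := by
      ring
    linarith

/-- The relative error of the estimated block intensities when the fluctuations of the block sums
are at most `s` times their typical size `n d² θ₀ / K²`. -/
noncomputable def relError (α β γ s ησ ηz : ℝ) (K : ℕ) : ℝ :=
  64 * α * β ^ 2 * s + 256 * α * β ^ 3 * γ * (K * ησ) + 4 * α * γ * ηz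

/-- On the noise event, an accurate initialization estimates all block intensities well. -/
lemma abs_Bhat_sub_le {n d K : ℕ} {p : Params n d K} {θ₀ α β γ ησ ηz s : ℝ}
    (hp : p.InSpace θ₀ α β γ) (hθ : 0 < θ₀) (hα : 1 ≤ α) (hβ : 1 ≤ β) (hγ : 1 ≤ γ)
    (hn : 0 < n) (hd : 0 < d) (hK : 0 < K) (hs0 : 0 ≤ s) (hησ0 : 0 ≤ ησ)
    (hησ : 2 * β * (K * ησ) ≤ 1) (hηz : 4 * α * ηz ≤ 1)
    {i : Fin n} {X : Fin n → Network d}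
    (hX : NoiseGood p ησ ηz (s * (n * d ^ 2 * θ₀ / K ^ 2)) i X) {w : InitOutput n d K i}
    {π : Equiv.Perm (Fin 2)}
    (hw : ((Finset.univ.filter fun j => withDummy i w.1 j ≠ some (π (p.z j))).card : ℝ) / n ≤ ηz)
    {m : Fin 2} {τ : Equiv.Perm (Fin K)} (hτ : errorUnder τ (w.2 (π m)) (p.σ m) ≤ ησ)
    (k l : Fin K) :
    |Bhat X i w (π m) (τ k) (τ l) - p.B m k l| ≤ relError α β γ s ησ ηz K * θ₀ := by
  have hn' : (0 : ℝ) < n := by exact_mod_cast hn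
  have hd' : (0 : ℝ) < d := by exact_mod_cast hd
  have hK' : (0 : ℝ) < K := by exact_mod_cast hK
  rw [div_le_iff₀ hn'] at hw
  set A := Finset.univ.filter fun j => withDummy i w.1 j ≠ some (π (p.z j)) with hA
  set r : Fin d → Fin K := fun u => τ.symm (w.2 (π m) u) with hr
  have hrdis : ((disagree r (p.σ m)).card : ℝ) ≤ ησ * d := by
    rw [errorUnder, Fintype.card_fin, div_le_iff₀ hd'] at hτ
    refine le_trans (le_of_eq ?_) hτ
    congr 2
    ext u
    simp [mem_disagree, hr, Equiv.symm_apply_eq]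
  have hblock : blockEdges (w.2 (π m)) (τ k) (τ l) = blockEdges r k l := by
    ext e
    simp [mem_blockEdges, hr, Joins, Equiv.symm_apply_eq]
  obtain ⟨hE1, -, hE3⟩ := card_blockEdges_bounds hp hβ hK hησ hrdis k l
  set E := blockEdges r k l with hE
  set J := otherLayers p i m with hJ
  set J' := estLayers w (π m) with hJ'
  have hmemJ : ∀ j, j ∈ J ↔ j ≠ i ∧ p.z j = m := fun j => by simp [hJ, otherLayers]
  have hmemJ' : ∀ j, j ∈ J' ↔ withDummy i w.1 j = some (π m) := fun j => by
    simp [hJ', estLayers]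
  have hmemA : ∀ j, j ∈ A ↔ withDummy i w.1 j ≠ some (π (p.z j)) := fun j => by simp [hA]
  set D := A.erase i with hD
  have hJD : J \ J' ⊆ D := fun j hj => by
    rw [Finset.mem_sdiff, hmemJ, hmemJ'] at hj
    rw [hD, Finset.mem_erase, hmemA, hj.1.2]
    exact ⟨hj.1.1, hj.2⟩
  have hJ'D : J' \ J ⊆ D := fun j hj => by
    rw [Finset.mem_sdiff, hmemJ, hmemJ'] at hj
    have hji : j ≠ i := fun h => by simp [withDummy, h] at hj
    rw [hD, Finset.mem_erase, hmemA, hj.1]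
    refine ⟨hji, fun h => hj.2 ⟨hji, ?_⟩⟩
    exact (π.injective (Option.some.inj h)).symm
  have hDcard : (D.card : ℝ) ≤ ηz * n :=
    le_trans (by exact_mod_cast Finset.card_le_card (Finset.erase_subset _ _)) hw
  have hJcard : (J.card : ℝ) ≤ n := by
    have := Finset.card_le_univ J
    rw [Fintype.card_fin] at this
    exact_mod_cast this
  have hJ'card : (n : ℝ) / (4 * α) ≤ J'.card := by
    have h1 := hp.layer_lower m
    have h2 : (Finset.univ.filter fun j => p.z j = m).card ≤ J'.card + A.card := by
      refine le_trans (Finset.card_le_card fun j hj => ?_) (Finset.card_union_le _ _)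
      rw [Finset.mem_union, hmemJ', hmemA, (Finset.mem_filter.1 hj).2]
      tauto
    have h2' : ((Finset.univ.filter fun j => p.z j = m).card : ℝ) ≤ J'.card + A.card := by
      exact_mod_cast h2
    have h3 : ηz * n ≤ n / (4 * α) := by
      rw [le_div_iff₀ (by positivity)]
      nlinarith
    have h4 : (n : ℝ) / (2 * α) = 2 * (n / (4 * α)) := by
      field_simp
      norm_num
    linarith
  have hmain := abs_blockSum_sub_le (x := fun j e => (X j e : ℝ)) (fun j e => Nat.cast_nonneg _)
    (P := p.P m) (B := p.B m k l) (b := γ * θ₀) hJD hJ'D (E := E) (W := wrongEdges r (p.σ m))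
    (fun e he hw => p.P_eq_of_mem_blockEdges (hp.symm m) he hw)
    (fun e => by
      have h1 := hp.P_lower m e
      have h2 := hp.P_upper m e
      have h3 := hp.lower m k l
      have h4 := hp.upper m k l
      rw [abs_le]
      constructor <;> linarith)
    (hθ.le.trans (hp.lower m k l)) (hp.upper m k l)
    (hX.dev m r hrdis k l) (hX.small m r hrdis D (by simp [hD]) hDcard k l)
  have hpos1 : (0 : ℝ) < J'.card := lt_of_lt_of_le (by positivity) hJ'card
  have hpos2 : (0 : ℝ) < E.card := lt_of_lt_of_le (by positivity) hE1
  have hden : (0 : ℝ) < J'.card * E.card := mul_pos hpos1 hpos2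
  rw [Bhat_eq, hblock, ← hJ', div_sub' hden.ne', abs_div, abs_of_pos hden,
    div_le_iff₀ hden]
  refine hmain.trans ?_
  have hden_low : (n : ℝ) / (4 * α) * (d ^ 2 / (8 * β ^ 2 * K ^ 2)) ≤ J'.card * E.card := by
    gcongr
  have t1 : 2 * (s * (n * d ^ 2 * θ₀ / K ^ 2)) ≤
      64 * α * β ^ 2 * s * θ₀ * (J'.card * E.card) := by
    calc _ = 64 * α * β ^ 2 * s * θ₀ * (n / (4 * α) * (d ^ 2 / (8 * β ^ 2 * K ^ 2))) := by
          field_simp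
          ring
      _ ≤ _ := by gcongr
  have t2 : (J.card : ℝ) * (E ∩ wrongEdges r (p.σ m)).card * (γ * θ₀) ≤
      256 * α * β ^ 3 * γ * (K * ησ) * θ₀ * (J'.card * E.card) := by
    calc (J.card : ℝ) * (E ∩ wrongEdges r (p.σ m)).card * (γ * θ₀)
        ≤ n * (8 * β * ησ * d ^ 2 / K) * (γ * θ₀) := by gcongr
      _ = 256 * α * β ^ 3 * γ * (K * ησ) * θ₀ *
          (n / (4 * α) * (d ^ 2 / (8 * β ^ 2 * K ^ 2))) := by
          field_simp
          ring
      _ ≤ _ := by gcongr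
  have t3 : (D.card : ℝ) * E.card * (γ * θ₀) ≤ 4 * α * γ * ηz * θ₀ * (J'.card * E.card) := by
    have hηz0 : 0 ≤ ηz := by
      by_contra h
      have : ηz * n < 0 := mul_neg_of_neg_of_pos (not_le.1 h) hn'
      have : (0 : ℝ) ≤ A.card := by positivity
      linarith
    calc (D.card : ℝ) * E.card * (γ * θ₀) ≤ ηz * n * E.card * (γ * θ₀) := by gcongr
      _ = 4 * α * γ * ηz * θ₀ * (n / (4 * α) * E.card) := by
          field_simp
      _ ≤ _ := by gcongr
  rw [relError]
  linarith

/-- The estimated intensities of the true class `m` are of the right order and close to the true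
ones in mean square. -/
lemma Phat_bounds {n d K : ℕ} {p : Params n d K} {θ₀ α β γ ησ ηz s : ℝ}
    (hp : p.InSpace θ₀ α β γ) (hθ : 0 < θ₀) (hα : 1 ≤ α) (hβ : 1 ≤ β) (hγ : 1 ≤ γ)
    (hn : 0 < n) (hd : 0 < d) (hK : 0 < K) (hs0 : 0 ≤ s) (hησ0 : 0 ≤ ησ)
    (hησ : 2 * β * (K * ησ) ≤ 1) (hηz : 4 * α * ηz ≤ 1)
    (hrel : relError α β γ s ησ ηz K ≤ 1 / 2)
    {i : Fin n} {X : Fin n → Network d}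
    (hX : NoiseGood p ησ ηz (s * (n * d ^ 2 * θ₀ / K ^ 2)) i X) {w : InitOutput n d K i}
    {π : Equiv.Perm (Fin 2)}
    (hw : ((Finset.univ.filter fun j => withDummy i w.1 j ≠ some (π (p.z j))).card : ℝ) / n ≤ ηz)
    {m : Fin 2} (hσ : clusterError (w.2 (π m)) (p.σ m) ≤ ησ) :
    (∀ e, θ₀ / 2 ≤ Phat X i w (π m) e) ∧
      ∑ e, (Phat X i w (π m) e - p.P m e) ^ 2 ≤
        d ^ 2 * θ₀ * (relError α β γ s ησ ηz K ^ 2 + 8 * γ ^ 2 * ησ) * θ₀ := by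
  obtain ⟨τ, -, hτ⟩ := Finset.exists_mem_eq_inf' (⟨1, Finset.mem_univ _⟩ :
    (Finset.univ : Finset (Equiv.Perm (Fin K))).Nonempty)
    fun τ => errorUnder τ (w.2 (π m)) (p.σ m)
  have hτ' : errorUnder τ (w.2 (π m)) (p.σ m) ≤ ησ := by
    rw [← hτ]
    exact hσ
  have hB := abs_Bhat_sub_le hp hθ hα hβ hγ hn hd hK hs0 hησ0 hησ hηz hX hw hτ'
  set ρ := relError α β γ s ησ ηz K with hρ
  have hd' : (0 : ℝ) < d := by exact_mod_cast hd
  set r : Fin d → Fin K := fun u => τ.symm (w.2 (π m) u) with hr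
  have hP : ∀ e, Phat X i w (π m) e = Bhat X i w (π m) (τ (r e.1.1)) (τ (r e.1.2)) := fun e => by
    simp [Phat, hr]
  have hB' : ∀ e : Edge d, |Phat X i w (π m) e - p.B m (r e.1.1) (r e.1.2)| ≤ ρ * θ₀ := fun e => by
    rw [hP]
    exact hB _ _
  have hrdis : ((disagree r (p.σ m)).card : ℝ) ≤ ησ * d := by
    rw [errorUnder, Fintype.card_fin, div_le_iff₀ hd'] at hτ'
    refine le_trans (le_of_eq ?_) hτ'
    congr 2
    ext u
    simp [mem_disagree, hr, Equiv.symm_apply_eq]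
  have hwrong : ((wrongEdges r (p.σ m)).card : ℝ) ≤ 2 * (ησ * d * d) := by
    have h : ((wrongEdges r (p.σ m)).card : ℝ) ≤ 2 * ((disagree r (p.σ m)).card * d) := by
      exact_mod_cast card_wrongEdges_le r (p.σ m)
    nlinarith
  have hρθ : ρ * θ₀ ≤ θ₀ / 2 := by nlinarith
  refine ⟨fun e => ?_, ?_⟩
  · have h1 := (abs_le.1 (hB' e)).1
    have h2 := hp.lower m (r e.1.1) (r e.1.2)
    linarith
  · have hterm : ∀ e, (Phat X i w (π m) e - p.P m e) ^ 2 ≤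
        ρ ^ 2 * θ₀ ^ 2 + if e ∈ wrongEdges r (p.σ m) then 4 * γ ^ 2 * θ₀ ^ 2 else 0 := fun e => by
      have h := hB' e
      split_ifs with hw
      · have h2 := hp.lower m (r e.1.1) (r e.1.2)
        have h3 := hp.upper m (r e.1.1) (r e.1.2)
        have h4 := hp.P_lower m e
        have h5 := hp.P_upper m e
        obtain ⟨h6, h7⟩ := abs_le.1 h
        have hγθ : θ₀ ≤ γ * θ₀ := by nlinarith
        have h8 : (Phat X i w (π m) e - p.P m e) ^ 2 ≤ (2 * γ * θ₀) ^ 2 :=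
          sq_le_sq' (by linarith) (by linarith)
        have : 0 ≤ ρ ^ 2 * θ₀ ^ 2 := by positivity
        nlinarith
      · have heq : p.B m (r e.1.1) (r e.1.2) = p.P m e := by
          simp only [wrongEdges, mem_disagree, Finset.mem_filter, Finset.mem_univ, true_and,
            not_or, not_not] at hw
          rw [Params.P, hw.1, hw.2]
        rw [heq] at h
        rw [add_zero, ← mul_pow, ← sq_abs]
        gcongr
    calc ∑ e, (Phat X i w (π m) e - p.P m e) ^ 2
        ≤ ∑ e : Edge d, (ρ ^ 2 * θ₀ ^ 2 +
            if e ∈ wrongEdges r (p.σ m) then 4 * γ ^ 2 * θ₀ ^ 2 else 0) :=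
          Finset.sum_le_sum fun e _ => hterm e
      _ = Fintype.card (Edge d) * (ρ ^ 2 * θ₀ ^ 2) +
            (wrongEdges r (p.σ m)).card * (4 * γ ^ 2 * θ₀ ^ 2) := by
          rw [Finset.sum_add_distrib, Finset.sum_const, Finset.sum_ite_mem, Finset.univ_inter,
            Finset.sum_const]
          simp
      _ ≤ d ^ 2 * (ρ ^ 2 * θ₀ ^ 2) + 2 * (ησ * d * d) * (4 * γ ^ 2 * θ₀ ^ 2) := by
          have : (Fintype.card (Edge d) : ℝ) ≤ d ^ 2 := by exact_mod_cast card_edge_le d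
          gcongr
      _ = _ := by ring

/-! ### The likelihood ratio test with plug-in intensities -/

section Test

lemma coe_sum_ereal {ι : Type*} (s : Finset ι) (f : ι → ℝ) :
    ((∑ e ∈ s, f e : ℝ) : EReal) = ∑ e ∈ s, (f e : EReal) := by
  classical
  induction s using Finset.induction_on with
  | empty => simp
  | insert a s ha ih => rw [Finset.sum_insert ha, Finset.sum_insert ha, EReal.coe_add, ih]

lemma logLik_of_pos {r : ℝ} (hr : 0 < r) (x : ℕ) :
    logLik r x = ((-r + x * Real.log r : ℝ) : EReal) := by
  rw [logLik, if_neg fun h => hr.ne' h.1]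

/-- The Chernoff exponent at `1 / 2` of the likelihood ratio test with plug-in intensities
`a'`, `b'` for a Poisson variable of mean `a`, compared with its value at the true intensities
`a`, `b`. -/
lemma chernoff_exponent_le {a b a' b' θ δ : ℝ} (hθ : 0 < θ) (hδ : 0 < δ) (hδ1 : δ ≤ 1)
    (ha : θ ≤ a) (hb : θ ≤ b) (ha' : θ / 2 ≤ a') (hb' : θ / 2 ≤ b') :
    (a' - b') / 2 + a * (√b' / √a' - 1) ≤
      -((1 - δ) / 2) * (√a - √b) ^ 2 + (1 + 4 / δ) * (((a' - a) ^ 2 + (b' - b) ^ 2) / θ) := by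
  have ha0 : 0 < a := hθ.trans_le ha
  have hb0 : 0 < b := hθ.trans_le hb
  have ha'0 : 0 < a' := by linarith
  have hb'0 : 0 < b' := by linarith
  -- the square roots of the plug-in intensities are close to the true ones
  have hroot : ∀ u v : ℝ, θ ≤ u → 0 < v → (√v - √u) ^ 2 ≤ (v - u) ^ 2 / θ := by
    intro u v hu hv
    have hu0 : 0 < u := hθ.trans_le hu
    rw [le_div_iff₀ hθ]
    have h1 : v - u = (√v - √u) * (√v + √u) := by
      nlinarith [Real.sq_sqrt hu0.le, Real.sq_sqrt hv.le]
    rw [h1, mul_pow]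
    have h2 : θ ≤ (√v + √u) ^ 2 := by
      nlinarith [Real.sq_sqrt hu0.le, Real.sq_sqrt hv.le, Real.sqrt_nonneg u, Real.sqrt_nonneg v,
        mul_nonneg (Real.sqrt_nonneg u) (Real.sqrt_nonneg v)]
    gcongr
  have hra := hroot a a' ha ha'0
  have hrb := hroot b b' hb hb'0
  have hx : 0 < √a' := Real.sqrt_pos.2 ha'0
  set x := √a' with hxdef
  set y := √b' with hydef
  have hx2 : x ^ 2 = a' := Real.sq_sqrt ha'0.le
  have hy2 : y ^ 2 = b' := Real.sq_sqrt hb'0.le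
  set g := (a - a') / x with hg
  have hg2 : g ^ 2 ≤ 2 * ((a' - a) ^ 2 / θ) := by
    rw [hg, div_pow, hx2, ← mul_div_assoc, div_le_div_iff₀ ha'0 hθ]
    nlinarith [sq_nonneg (a' - a)]
  have hlhs : (a' - b') / 2 + a * (y / x - 1) = -(1 / 2) * (x - y) ^ 2 + g * (y - x) := by
    rw [hg, ← hx2, ← hy2]
    field_simp
    ring
  rw [hlhs, add_div]
  set r₁ := (a' - a) ^ 2 / θ with hr₁
  set r₂ := (b' - b) ^ 2 / θ with hr₂
  have hr₂0 : 0 ≤ r₂ := by positivity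
  -- weighted arithmetic-geometric mean inequality for the cross term
  have hcross : g * (y - x) ≤ δ / 4 * (x - y) ^ 2 + 1 / δ * g ^ 2 := by
    have h : 0 ≤ (δ / 2 * (y - x) - g) ^ 2 / δ := by positivity
    have e : (δ / 2 * (y - x) - g) ^ 2 / δ =
        δ / 4 * (x - y) ^ 2 + 1 / δ * g ^ 2 - g * (y - x) := by
      field_simp
      ring
    linarith
  set Y := √a - √b with hY
  set E := (√b - y) - (√a - x) with hE
  have hE2 : E ^ 2 ≤ 2 * (r₁ + r₂) := by
    have : E ^ 2 ≤ 2 * ((y - √b) ^ 2 + (x - √a) ^ 2) := by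
      nlinarith [sq_nonneg ((√b - y) + (√a - x))]
    linarith
  have hxy : x - y = Y + E := by rw [hY, hE]; ring
  have hXY : (1 - δ / 2) * Y ^ 2 ≤ (x - y) ^ 2 + (2 / δ) * E ^ 2 := by
    have h : 0 ≤ (δ / 2 * Y + E) ^ 2 * (2 / δ) := by positivity
    have e : (δ / 2 * Y + E) ^ 2 * (2 / δ) = δ / 2 * Y ^ 2 + 2 * Y * E + 2 / δ * E ^ 2 := by
      field_simp
      ring
    have e' : (Y + E) ^ 2 = Y ^ 2 + 2 * Y * E + E ^ 2 := by ring
    rw [e] at h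
    rw [hxy, e']
    linarith [sq_nonneg E]
  have hδinv : 1 ≤ 1 / δ := by rw [le_div_iff₀ hδ]; linarith
  have h2δ : 2 / δ = 2 * (1 / δ) := by ring
  have h4δ : 4 / δ = 4 * (1 / δ) := by ring
  rw [h2δ] at hXY
  rw [h4δ]
  have hmul : (1 - δ / 2) * ((1 - δ / 2) * Y ^ 2) ≤
      (1 - δ / 2) * (x - y) ^ 2 + 2 * (1 / δ) * E ^ 2 := by
    have h := mul_le_mul_of_nonneg_left hXY (by linarith : (0 : ℝ) ≤ 1 - δ / 2)
    have : 0 ≤ δ / 2 * (2 * (1 / δ) * E ^ 2) := by positivity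
    linarith
  have hYδ : (1 - δ) * Y ^ 2 ≤ (1 - δ / 2) * ((1 - δ / 2) * Y ^ 2) := by
    have e' : (1 - δ / 2) * ((1 - δ / 2) * Y ^ 2) = (1 - δ) * Y ^ 2 + (δ / 2 * Y) ^ 2 := by ring
    rw [e']
    exact le_add_of_nonneg_right (sq_nonneg _)
  have hEδ : 1 / δ * E ^ 2 ≤ 1 / δ * (2 * (r₁ + r₂)) := by gcongr
  have hgδ : 1 / δ * g ^ 2 ≤ 1 / δ * (2 * r₁) := by gcongr
  have hr₁0 : 0 ≤ r₁ := by positivity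
  have hr₂δ : 0 ≤ 1 / δ * r₂ := by positivity
  linarith

variable {Ω : Type*} [MeasurableSpace Ω] {n d K : ℕ} {p : Params n d K}
  {X : Ω → Fin n → Network d} {μ : Measure Ω} [IsProbabilityMeasure μ]

/-- Chernoff's bound for linear combinations of the data, with the class intensities. -/
lemma IsMMPBM.measureReal_le (hX : IsMMPBM p X μ) (hP : ∀ m e, 0 ≤ p.P m e)
    (c : Fin n → Edge d → ℝ) (a : ℝ) :
    μ.real {ω | a ≤ ∑ j, ∑ e, c j e * (X ω j e : ℝ)} ≤
      Real.exp (-a + ∑ j, ∑ e, p.P (p.z j) e * (Real.exp (c j e) - 1)) := by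
  have hm : ∀ q : Fin n × Edge d, Measurable fun ω => X ω q.1 q.2 := fun q =>
    (measurable_pi_apply q.2).comp ((measurable_pi_apply q.1).comp hX.meas)
  have h := measureReal_le_sum_poisson_le (r := fun q : Fin n × Edge d => p.P (p.z q.1) q.2)
    (fun q => hP _ _) hm hX.indep (fun q => hX.law q.1 q.2) (fun q => c q.1 q.2) a
  simpa only [Fintype.sum_prod_type] using h

/-- Error probability of the likelihood ratio test for layer `i` with fixed plug-in intensities
`Q` for the true class and `Q'` for the other one. -/
lemma IsMMPBM.measureReal_test_le (hX : IsMMPBM p X μ) {θ₀ α β γ κ δ : ℝ}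
    (hp : p.InSpace θ₀ α β γ) (hθ : 0 < θ₀) (hδ : 0 < δ) (hδ1 : δ ≤ 1) (i : Fin n)
    {m : Fin 2} (hm : m ≠ p.z i) {Q Q' : Edge d → ℝ} (hQ : ∀ e, θ₀ / 2 ≤ Q e)
    (hQ' : ∀ e, θ₀ / 2 ≤ Q' e)
    (hQP : ∑ e, (Q e - p.P (p.z i) e) ^ 2 ≤ κ * p.signal * θ₀)
    (hQP' : ∑ e, (Q' e - p.P m e) ^ 2 ≤ κ * p.signal * θ₀) :
    μ.real {ω | ∑ e, logLik (Q e) (X ω i e) ≤ ∑ e, logLik (Q' e) (X ω i e)} ≤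
      Real.exp (-((1 - δ) / 2) * p.signal + (1 + 4 / δ) * (2 * κ) * p.signal) := by
  have hQ0 : ∀ e, 0 < Q e := fun e => by linarith [hQ e]
  have hQ'0 : ∀ e, 0 < Q' e := fun e => by linarith [hQ' e]
  set c : Fin n → Edge d → ℝ := fun j e =>
    if j = i then Real.log √(Q' e) - Real.log √(Q e) else 0 with hc
  have hset : {ω | ∑ e, logLik (Q e) (X ω i e) ≤ ∑ e, logLik (Q' e) (X ω i e)} ⊆
      {ω | ∑ e, (Q' e - Q e) / 2 ≤ ∑ j, ∑ e, c j e * (X ω j e : ℝ)} := by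
    intro ω hω
    rw [Set.mem_ofPred_eq, Finset.sum_congr rfl fun e _ => logLik_of_pos (hQ0 e) _,
      Finset.sum_congr rfl fun e _ => logLik_of_pos (hQ'0 e) _, ← coe_sum_ereal,
      ← coe_sum_ereal, EReal.coe_le_coe_iff] at hω
    rw [Set.mem_ofPred_eq, Finset.sum_eq_single i
      (fun j _ hj => Finset.sum_eq_zero fun e _ => by simp [hc, hj]) (by simp)]
    have e1 : ∑ e, c i e * (X ω i e : ℝ) - ∑ e, (Q' e - Q e) / 2 =
        (∑ e, (-Q' e + X ω i e * Real.log (Q' e)) -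
          ∑ e, (-Q e + X ω i e * Real.log (Q e))) / 2 := by
      rw [← Finset.sum_sub_distrib, ← Finset.sum_sub_distrib, Finset.sum_div]
      refine Finset.sum_congr rfl fun e _ => ?_
      simp only [hc, if_true]
      rw [Real.log_sqrt (hQ0 e).le, Real.log_sqrt (hQ'0 e).le]
      ring
    linarith
  refine (measureReal_mono hset).trans ((hX.measureReal_le
    (fun m e => hθ.le.trans (hp.P_lower m e)) c _).trans (Real.exp_le_exp.2 ?_))
  have e2 : -(∑ e, (Q' e - Q e) / 2) + ∑ j, ∑ e, p.P (p.z j) e * (Real.exp (c j e) - 1) =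
      ∑ e, ((Q e - Q' e) / 2 + p.P (p.z i) e * (√(Q' e) / √(Q e) - 1)) := by
    rw [Finset.sum_eq_single i
      (fun j _ hj => Finset.sum_eq_zero fun e _ => by simp [hc, hj]) (by simp),
      ← Finset.sum_neg_distrib, ← Finset.sum_add_distrib]
    refine Finset.sum_congr rfl fun e _ => ?_
    simp only [hc, if_true]
    rw [Real.exp_sub, Real.exp_log (Real.sqrt_pos.2 (hQ0 e)),
      Real.exp_log (Real.sqrt_pos.2 (hQ'0 e))]
    ring
  have hsignal : ∑ e, (√(p.P (p.z i) e) - √(p.P m e)) ^ 2 = p.signal := by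
    rw [Params.signal]
    refine Finset.sum_congr rfl fun e _ => ?_
    have h : ∀ a b : Fin 2, b ≠ a →
        (√(p.P a e) - √(p.P b e)) ^ 2 = (√(p.P 0 e) - √(p.P 1 e)) ^ 2 := by
      intro a b hab
      fin_cases a <;> fin_cases b
      · exact absurd rfl hab
      · rfl
      · exact sub_sq_comm _ _
      · exact absurd rfl hab
    exact h _ _ hm
  rw [e2]
  calc ∑ e, ((Q e - Q' e) / 2 + p.P (p.z i) e * (√(Q' e) / √(Q e) - 1))
      ≤ ∑ e, (-((1 - δ) / 2) * (√(p.P (p.z i) e) - √(p.P m e)) ^ 2 + (1 + 4 / δ) *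
          (((Q e - p.P (p.z i) e) ^ 2 + (Q' e - p.P m e) ^ 2) / θ₀)) :=
        Finset.sum_le_sum fun e _ => chernoff_exponent_le hθ hδ hδ1 (hp.P_lower _ e)
          (hp.P_lower _ e) (hQ e) (hQ' e)
    _ = -((1 - δ) / 2) * p.signal + (1 + 4 / δ) * ((∑ e, (Q e - p.P (p.z i) e) ^ 2 +
          ∑ e, (Q' e - p.P m e) ^ 2) / θ₀) := by
        rw [Finset.sum_add_distrib, ← Finset.mul_sum, hsignal, ← Finset.mul_sum,
          ← Finset.sum_div, Finset.sum_add_distrib]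
    _ ≤ _ := by
        have h : (∑ e, (Q e - p.P (p.z i) e) ^ 2 + ∑ e, (Q' e - p.P m e) ^ 2) / θ₀ ≤
            2 * κ * p.signal := by
          rw [div_le_iff₀ hθ]
          linarith
        have := mul_le_mul_of_nonneg_left h (by positivity : (0 : ℝ) ≤ 1 + 4 / δ)
        linarith

end Test

/-! ### Probability of the noise event -/

section Noise

variable {Ω : Type*} [MeasurableSpace Ω] {n d K : ℕ} {p : Params n d K}
  {X : Ω → Fin n → Network d} {μ : Measure Ω} [IsProbabilityMeasure μ]

lemma sum_sum_ite_mem {ι κ : Type*} [Fintype ι] [Fintype κ] [DecidableEq ι] [DecidableEq κ]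
    (J : Finset ι) (E : Finset κ) (F : ι → κ → ℝ) :
    ∑ j, ∑ e, (if j ∈ J ∧ e ∈ E then F j e else 0) = ∑ j ∈ J, ∑ e ∈ E, F j e := by
  have h : ∀ j, ∑ e, (if j ∈ J ∧ e ∈ E then F j e else 0) =
      if j ∈ J then ∑ e ∈ E, F j e else 0 := fun j => by
    by_cases hj : j ∈ J <;> simp [hj]
  rw [Finset.sum_congr rfl fun j _ => h j]
  simp

/-- Chernoff's bound for the total weight of a rectangle of layers and edges. -/
lemma IsMMPBM.measureReal_blockSum_le (hX : IsMMPBM p X μ) (hP : ∀ m e, 0 ≤ p.P m e)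
    (J : Finset (Fin n)) (E : Finset (Edge d)) (t a : ℝ) :
    μ.real {ω | a ≤ t * ∑ j ∈ J, ∑ e ∈ E, (X ω j e : ℝ)} ≤
      Real.exp (-a + (∑ j ∈ J, ∑ e ∈ E, p.P (p.z j) e) * (Real.exp t - 1)) := by
  have h := hX.measureReal_le hP (fun j e => if j ∈ J ∧ e ∈ E then t else 0) a
  have h1 : ∀ ω, ∑ j, ∑ e, (if j ∈ J ∧ e ∈ E then t else 0) * (X ω j e : ℝ) =
      t * ∑ j ∈ J, ∑ e ∈ E, (X ω j e : ℝ) := fun ω => by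
    rw [Finset.mul_sum, Finset.sum_congr rfl fun j _ => Finset.mul_sum E _ t,
      ← sum_sum_ite_mem J E]
    simp only [ite_mul, zero_mul]
  have h2 : ∑ j, ∑ e, p.P (p.z j) e * (Real.exp (if j ∈ J ∧ e ∈ E then t else 0) - 1) =
      (∑ j ∈ J, ∑ e ∈ E, p.P (p.z j) e) * (Real.exp t - 1) := by
    rw [← sum_sum_ite_mem J E]
    simp only [Finset.sum_mul]
    refine Finset.sum_congr rfl fun j _ => Finset.sum_congr rfl fun e _ => ?_
    split_ifs <;> simp
  rw [h2] at h
  simpa only [h1] using h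

/-- Sub-Gaussian regime of the centred weight of a rectangle, for either sign of `t`. -/
lemma IsMMPBM.measureReal_centered_le (hX : IsMMPBM p X μ) (hP : ∀ m e, 0 ≤ p.P m e)
    {b V : ℝ} (hb : ∀ m e, p.P m e ≤ b) {m : Fin 2} {J : Finset (Fin n)}
    (hJ : ∀ j ∈ J, p.z j = m) (E : Finset (Edge d)) (hV : J.card * E.card * b ≤ V) {t : ℝ}
    (ht : |t| ≤ 1) (a : ℝ) :
    μ.real {ω | a ≤ t * ∑ j ∈ J, ∑ e ∈ E, ((X ω j e : ℝ) - p.P m e)} ≤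
      Real.exp (-a + V * t ^ 2) := by
  set S := ∑ j ∈ J, ∑ e ∈ E, p.P (p.z j) e with hS
  have hS' : ∑ j ∈ J, ∑ e ∈ E, p.P m e = S :=
    Finset.sum_congr rfl fun j hj => by rw [hJ j hj]
  have hS0 : 0 ≤ S := Finset.sum_nonneg fun j _ => Finset.sum_nonneg fun e _ => hP _ _
  have hSV : S ≤ V := by
    refine le_trans ?_ hV
    calc S ≤ ∑ j ∈ J, ∑ e ∈ E, b :=
          Finset.sum_le_sum fun j _ => Finset.sum_le_sum fun e _ => hb _ _
      _ = J.card * E.card * b := by simp [mul_assoc]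
  have h := hX.measureReal_blockSum_le hP J E t (a + t * S)
  have hset : {ω | a ≤ t * ∑ j ∈ J, ∑ e ∈ E, ((X ω j e : ℝ) - p.P m e)} =
      {ω | a + t * S ≤ t * ∑ j ∈ J, ∑ e ∈ E, (X ω j e : ℝ)} := by
    ext ω
    simp only [Set.mem_ofPred_eq, Finset.sum_sub_distrib, hS', mul_sub]
    exact le_sub_iff_add_le
  rw [hset]
  refine h.trans (Real.exp_le_exp.2 ?_)
  have hexp := (abs_le.1 (Real.abs_exp_sub_one_sub_id_le ht)).2
  have h1 : S * (Real.exp t - 1 - t) ≤ V * t ^ 2 :=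
    mul_le_mul hSV hexp (by linarith [Real.add_one_le_exp t]) (hS0.trans hSV)
  linarith

/-- Poisson tail of the weight of a rectangle, with a free Chernoff parameter. -/
lemma IsMMPBM.measureReal_weight_le (hX : IsMMPBM p X μ) (hP : ∀ m e, 0 ≤ p.P m e)
    {b M : ℝ} (hb : ∀ m e, p.P m e ≤ b) (J : Finset (Fin n)) (E : Finset (Edge d))
    (hM : J.card * E.card * b ≤ M) {t : ℝ} (ht : 0 < t) (u : ℝ) :
    μ.real {ω | u ≤ ∑ j ∈ J, ∑ e ∈ E, (X ω j e : ℝ)} ≤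
      Real.exp (-(t * u) + M * (Real.exp t - 1)) := by
  have h := hX.measureReal_blockSum_le hP J E t (t * u)
  simp only [mul_le_mul_iff_right₀ ht] at h
  refine h.trans (Real.exp_le_exp.2 ?_)
  have hS : ∑ j ∈ J, ∑ e ∈ E, p.P (p.z j) e ≤ M := by
    refine le_trans ?_ hM
    calc _ ≤ ∑ j ∈ J, ∑ e ∈ E, b :=
          Finset.sum_le_sum fun j _ => Finset.sum_le_sum fun e _ => hb _ _
      _ = J.card * E.card * b := by simp [mul_assoc]
  have h1 : 0 ≤ Real.exp t - 1 := by linarith [Real.add_one_le_exp t]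
  have := mul_le_mul_of_nonneg_right hS h1
  linarith

/-- The union bound behind `NoiseGood`: over the community assignments near the truth, the blocks,
and, for the mislabelled layers, the small sets of layers. -/
lemma IsMMPBM.measureReal_not_noiseGood_le (hX : IsMMPBM p X μ) {θ₀ α β γ ησ ηz u t t' Nσ Nz : ℝ}
    (hp : p.InSpace θ₀ α β γ) (hθ : 0 < θ₀) (hβ : 1 ≤ β) (hγ : 1 ≤ γ) (hK : 0 < K)
    (hησ : 2 * β * (K * ησ) ≤ 1) (i : Fin n)
    (hNσ : ∀ m, ((Finset.univ.filter fun s : Fin d → Fin K =>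
      ((disagree s (p.σ m)).card : ℝ) ≤ ησ * d).card : ℝ) ≤ Nσ)
    (hNz : ((Finset.univ.filter fun s : Fin n → Bool =>
      ((disagree s fun _ => false).card : ℝ) ≤ ηz * n).card : ℝ) ≤ Nz)
    (ht : 0 ≤ t) (ht1 : t ≤ 1) (ht' : 0 < t') :
    μ.real {ω | ¬ NoiseGood p ησ ηz u i (X ω)} ≤
      2 * K ^ 2 * Nσ * (2 * Real.exp (-(t * u) +
        8 * β ^ 2 * γ * (n * d ^ 2 * θ₀ / K ^ 2) * t ^ 2) +
        Nz * Real.exp (-(t' * u) +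
          ηz * (8 * β ^ 2 * γ * (n * d ^ 2 * θ₀ / K ^ 2)) * (Real.exp t' - 1))) := by
  set V := 8 * β ^ 2 * γ * (n * d ^ 2 * θ₀ / K ^ 2) with hV
  have hP : ∀ m e, 0 ≤ p.P m e := fun m e => hθ.le.trans (hp.P_lower m e)
  have hPb : ∀ m e, p.P m e ≤ γ * θ₀ := hp.P_upper
  set Sσ : Fin 2 → Finset (Fin d → Fin K) := fun m => Finset.univ.filter fun s =>
    ((disagree s (p.σ m)).card : ℝ) ≤ ησ * d with hSσ
  set Sz : Finset (Fin n → Bool) := Finset.univ.filter fun s =>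
    ((disagree s fun _ => false).card : ℝ) ≤ ηz * n with hSz
  set F : Fin 2 → (Fin d → Fin K) → Fin K → Fin K → Set Ω := fun m s k l =>
    {ω | t * u ≤ t * ∑ j ∈ otherLayers p i m, ∑ e ∈ blockEdges s k l,
      ((X ω j e : ℝ) - p.P m e)} ∪
    {ω | t * u ≤ (-t) * ∑ j ∈ otherLayers p i m, ∑ e ∈ blockEdges s k l,
      ((X ω j e : ℝ) - p.P m e)} with hF
  set H : (Fin d → Fin K) → Fin K → Fin K → (Fin n → Bool) → Set Ω := fun s k l D =>
    {ω | u ≤ ∑ j ∈ disagree D fun _ => false, ∑ e ∈ blockEdges s k l, (X ω j e : ℝ)} with hH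
  have hsub : {ω | ¬ NoiseGood p ησ ηz u i (X ω)} ⊆
      ⋃ m, ⋃ s ∈ Sσ m, ⋃ k, ⋃ l, (F m s k l ∪ ⋃ D ∈ Sz, H s k l D) := by
    intro ω hω
    by_contra hcon
    simp only [Set.mem_iUnion, Set.mem_union, not_exists, not_or] at hcon
    refine hω ⟨fun m s hs k l => ?_, fun m s hs D _ hD k l => ?_⟩
    · have h := (hcon m s (by simpa [hSσ] using hs) k l).1
      simp only [hF, Set.mem_union, Set.mem_ofPred_eq, not_or, not_le] at h
      have ht0 : 0 < t := by
        refine lt_of_le_of_ne ht fun h0 => ?_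
        simp [← h0] at h
      rw [abs_le]
      constructor
      · nlinarith [h.2]
      · nlinarith [h.1]
    · have hDeq : disagree (fun j => decide (j ∈ D)) (fun _ => false) = D := by
        ext j
        simp [mem_disagree]
      have h := (hcon m s (by simpa [hSσ] using hs) k l).2 (fun j => decide (j ∈ D))
        (by simpa [hSz, hDeq] using hD)
      simp only [hH, Set.mem_ofPred_eq, not_le, hDeq] at h
      exact h.le
  have hE : ∀ m, ∀ s ∈ Sσ m, ∀ k l, ((blockEdges s k l).card : ℝ) ≤ 8 * β ^ 2 * d ^ 2 / K ^ 2 :=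
    fun m s hs k l => (card_blockEdges_bounds hp hβ hK hησ (m := m)
      (Finset.mem_filter.1 hs).2 k l).2.1
  have hVeq : (n : ℝ) * (8 * β ^ 2 * d ^ 2 / K ^ 2) * (γ * θ₀) = V := by
    rw [hV]
    ring
  have hFle : ∀ m, ∀ s ∈ Sσ m, ∀ k l,
      μ.real (F m s k l) ≤ 2 * Real.exp (-(t * u) + V * t ^ 2) := by
    intro m s hs k l
    have hJ : ∀ j ∈ otherLayers p i m, p.z j = m := fun j hj => (Finset.mem_filter.1 hj).2.2
    have hc : ((otherLayers p i m).card : ℝ) * (blockEdges s k l).card * (γ * θ₀) ≤ V := by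
      rw [← hVeq]
      have h1 : ((otherLayers p i m).card : ℝ) ≤ n := by
        have := Finset.card_le_univ (otherLayers p i m)
        rw [Fintype.card_fin] at this
        exact_mod_cast this
      have h2 := hE m s hs k l
      gcongr
    have h1 := hX.measureReal_centered_le hP hPb hJ (blockEdges s k l) hc (t := t)
      (by rwa [abs_of_nonneg ht]) (t * u)
    have h2 := hX.measureReal_centered_le hP hPb hJ (blockEdges s k l) hc (t := -t)
      (by rwa [abs_neg, abs_of_nonneg ht]) (t * u)
    rw [neg_sq] at h2
    rw [two_mul]
    exact (measureReal_union_le _ _).trans (add_le_add h1 h2)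
  have hHle : ∀ m, ∀ s ∈ Sσ m, ∀ k l, μ.real (⋃ D ∈ Sz, H s k l D) ≤
      Nz * Real.exp (-(t' * u) + ηz * V * (Real.exp t' - 1)) := by
    intro m s hs k l
    refine (measureReal_biUnion_finset_le _ _).trans
      ((Finset.sum_le_card_nsmul _ _
        (Real.exp (-(t' * u) + ηz * V * (Real.exp t' - 1))) fun D hD => ?_).trans ?_)
    · have hDc : ((disagree D fun _ => false).card : ℝ) ≤ ηz * n := (Finset.mem_filter.1 hD).2
      refine hX.measureReal_weight_le hP hPb _ _ ?_ ht' u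
      have h2 := hE m s hs k l
      have hz : 0 ≤ ηz * n := (Nat.cast_nonneg _).trans hDc
      calc _ ≤ ηz * n * (8 * β ^ 2 * d ^ 2 / K ^ 2) * (γ * θ₀) := by gcongr
        _ = ηz * V := by rw [← hVeq]; ring
    · rw [nsmul_eq_mul]
      gcongr
  set C := 2 * Real.exp (-(t * u) + V * t ^ 2) +
    Nz * Real.exp (-(t' * u) + ηz * V * (Real.exp t' - 1)) with hC
  have hC0 : 0 ≤ C := by
    have : 0 ≤ Nz := (Nat.cast_nonneg _).trans hNz
    positivity
  refine (measureReal_mono hsub).trans ((measureReal_iUnion_fintype_le _).trans ?_)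
  have hm : ∀ m, μ.real (⋃ s ∈ Sσ m, ⋃ k, ⋃ l, (F m s k l ∪ ⋃ D ∈ Sz, H s k l D)) ≤
      Nσ * ((K : ℝ) ^ 2 * C) := by
    intro m
    refine (measureReal_biUnion_finset_le _ _).trans
      ((Finset.sum_le_card_nsmul _ _ ((K : ℝ) ^ 2 * C) fun s hs => ?_).trans ?_)
    · refine (measureReal_iUnion_fintype_le _).trans
        ((Finset.sum_le_card_nsmul _ _ ((K : ℝ) * C) fun k _ => ?_).trans ?_)
      · refine (measureReal_iUnion_fintype_le _).trans
          ((Finset.sum_le_card_nsmul _ _ C fun l _ => ?_).trans ?_)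
        · exact (measureReal_union_le _ _).trans (add_le_add (hFle m s hs k l) (hHle m s hs k l))
        · simp
      · simp [sq, mul_assoc]
    · rw [nsmul_eq_mul]
      have := hNσ m
      gcongr
  calc _ ≤ ∑ _m : Fin 2, Nσ * ((K : ℝ) ^ 2 * C) := Finset.sum_le_sum fun m _ => hm m
    _ = _ := by
      simp
      ring

end Noise

/-! ### Alignment of the runs and the leave-one-out argument -/

/-- The initialization is accurate under the identification `π` of the estimated and the true
classes. -/
def AccurateUnder {n d K : ℕ} (p : Params n d K) (ηz ησ : ℝ) (i : Fin n) (w : InitOutput n d K i)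
    (π : Equiv.Perm (Fin 2)) : Prop :=
  ((Finset.univ.filter fun j => withDummy i w.1 j ≠ some (π (p.z j))).card : ℝ) / n ≤ ηz ∧
    ∀ m, clusterError (w.2 (π m)) (p.σ m) ≤ ησ

/-- For some admissible identification of the classes, the estimated likelihood of layer `i` does
not strictly prefer its true class. -/
def TestFails {n d K : ℕ} (p : Params n d K) (ηz ησ : ℝ) (i : Fin n) (w : InitOutput n d K i)
    (X : Fin n → Network d) : Prop :=
  ∃ π, AccurateUnder p ηz ησ i w π ∧
    ∃ m, m ≠ p.z i ∧ score X i w (π (p.z i)) ≤ score X i w (π m)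

lemma clusterError_nonneg {ι L : Type*} [Fintype ι] [Fintype L] [DecidableEq L] (z z' : ι → L) :
    0 ≤ clusterError z z' :=
  Finset.le_inf' _ _ fun π _ => by
    rw [errorUnder]
    positivity

lemma clusterError_le_one {ι L : Type*} [Fintype ι] [Fintype L] [DecidableEq L] (z z' : ι → L) :
    clusterError z z' ≤ 1 := by
  refine (Finset.inf'_le _ (Finset.mem_univ (1 : Equiv.Perm L))).trans ?_
  exact div_le_one_of_le₀ (by exact_mod_cast Finset.card_le_univ _) (by positivity)

open Classical in
/-- Alignment: if all initializations are accurate, the runs are matched correctly to the first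
one, and a layer can only be misclassified by the output if its likelihood test fails. -/
lemma clusterError_le_card_testFails {n d K : ℕ} {p : Params n d K} {θ₀ α β γ ηz ησ : ℝ}
    (hp : p.InSpace θ₀ α β γ) (hα : 1 ≤ α) (hηz : 8 * α * ηz < 1) (hn : 0 < n)
    {X : Fin n → Network d} {w : ∀ i, InitOutput n d K i} {zhat : Fin n → Fin 2}
    (hout : IsTwoStageOutput X w zhat) (hacc : ∀ i, InitAccurate p ηz ησ i (w i)) :
    clusterError zhat p.z ≤
      ((Finset.univ.filter fun i => TestFails p ηz ησ i (w i) X).card : ℝ) / n := by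
  obtain ⟨zloc, hloc, hmax, hfirst, halign⟩ := hout
  choose π hπ using hacc
  have hn' : (0 : ℝ) < n := by exact_mod_cast hn
  set o : Fin n := ⟨0, hn⟩ with ho
  set Bad : Fin n → Finset (Fin n) := fun i =>
    Finset.univ.filter fun j => withDummy i (w i).1 j ≠ some (π i (p.z j)) with hBad
  have hcard : ∀ i, ((Bad i).card : ℝ) ≤ ηz * n := fun i => (div_le_iff₀ hn').1 (hπ i).1
  have hgood : ∀ i j, j ∉ Bad i → zloc i j = π i (p.z j) := fun i j hj => by
    have h : withDummy i (w i).1 j = some (π i (p.z j)) := by simpa [hBad] using hj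
    have hji : j ≠ i := fun h' => by simp [withDummy, h'] at h
    rw [hloc i j hji]
    simpa [withDummy, hji] using h
  have key : ∀ i, zloc i i = π i (p.z i) → zhat i = π o (p.z i) := by
    intro i hi
    by_cases h0 : i.val = 0
    · have hio : i = o := Fin.ext h0
      rw [hfirst i h0, hi, hio]
    · by_contra hne
      have h := halign i h0 (π o (p.z i))
      rw [hi, show (⟨0, i.pos⟩ : Fin n) = o from rfl] at h
      -- the class of `i` is contained in the left-hand set up to errors, and the right-hand set
      -- consists of errors
      have h1 : (Finset.univ.filter fun j => p.z j = p.z i) ⊆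
          (Finset.univ.filter fun j => zloc o j = π o (p.z i) ∧ zloc i j = π i (p.z i)) ∪
            (Bad o ∪ Bad i) := by
        intro j hj
        have hj' := (Finset.mem_filter.1 hj).2
        by_cases hjb : j ∈ Bad o ∪ Bad i
        · exact Finset.mem_union_right _ hjb
        · rw [Finset.mem_union, not_or] at hjb
          refine Finset.mem_union_left _ (Finset.mem_filter.2 ⟨Finset.mem_univ _, ?_, ?_⟩)
          · rw [hgood o j hjb.1, hj']
          · rw [hgood i j hjb.2, hj']
      have h2 : (Finset.univ.filter fun j => zloc o j = zhat i ∧ zloc i j = π i (p.z i)) ⊆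
          Bad o ∪ Bad i := by
        intro j hj
        have hj' := (Finset.mem_filter.1 hj).2
        by_contra hjb
        rw [Finset.mem_union, not_or] at hjb
        rw [hgood o j hjb.1, hgood i j hjb.2] at hj'
        have := (π i).injective hj'.2
        rw [this] at hj'
        exact hne hj'.1.symm
      have h3 := (Finset.card_le_card h1).trans (Finset.card_union_le _ _)
      have h4 := Finset.card_le_card h2
      have h5 := Finset.card_union_le (Bad o) (Bad i)
      have h6 : (Finset.univ.filter fun j => p.z j = p.z i).card ≤
          2 * ((Bad o).card + (Bad i).card) := by
        have h' := h.trans h4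
        omega
      have h7 : ((Finset.univ.filter fun j => p.z j = p.z i).card : ℝ) ≤
          2 * ((Bad o).card + (Bad i).card) := by exact_mod_cast h6
      have h8 := (hp.layer_lower (p.z i)).trans h7
      have h9 : (n : ℝ) / (2 * α) ≤ 4 * (ηz * n) := by linarith [hcard o, hcard i]
      rw [div_le_iff₀ (by positivity)] at h9
      nlinarith
  calc clusterError zhat p.z ≤ errorUnder (π o) zhat p.z :=
        Finset.inf'_le _ (Finset.mem_univ _)
    _ ≤ _ := by
        rw [errorUnder, Fintype.card_fin]
        gcongr with i hi
        intro hne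
        refine ⟨π i, hπ i, (π i).symm (zloc i i), fun h => ?_, ?_⟩
        · rw [Equiv.symm_apply_eq] at h
          exact hne (key i h)
        · rw [Equiv.apply_symm_apply]
          exact hmax i _

/-- Insert the network `x` as layer `i` into the data `y` of the other layers. -/
def insertLayer {n d : ℕ} (i : Fin n) (x : Network d) (y : {j : Fin n // j ≠ i} → Network d)
    (j : Fin n) : Network d :=
  if h : j ≠ i then y ⟨j, h⟩ else x

lemma insertLayer_self {n d : ℕ} (i : Fin n) (x : Network d)
    (y : {j : Fin n // j ≠ i} → Network d) : insertLayer i x y i = x := by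
  simp [insertLayer]

lemma insertLayer_of_ne {n d : ℕ} {i : Fin n} (x x' : Network d)
    (y : {j : Fin n // j ≠ i} → Network d) {j : Fin n} (hj : j ≠ i) :
    insertLayer i x y j = insertLayer i x' y j := by
  simp [insertLayer, hj]

lemma insertLayer_restrict {n d : ℕ} (i : Fin n) (X : Fin n → Network d) :
    insertLayer i (X i) (fun j => X j) = X := by
  ext j
  by_cases h : j = i
  · subst h
    simp [insertLayer]
  · simp [insertLayer, h]

section Layer

variable {Ω : Type*} [MeasurableSpace Ω] {n d K : ℕ} {p : Params n d K}
  {X : Ω → Fin n → Network d} {μ : Measure Ω} [IsProbabilityMeasure μ]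

/-- A layer is independent of the other layers together with the seed. -/
lemma IsMMPBM.indepFun_layer (hX : IsMMPBM p X μ) {S : Type*} [MeasurableSpace S] {U : Ω → S}
    (hU : Measurable U) (hUX : IndepFun U X μ) (i : Fin n) :
    IndepFun (fun ω => X ω i)
      (fun ω => (U ω, fun j : {j : Fin n // j ≠ i} => X ω j)) μ := by
  classical
  have hXm := hX.meas
  have hm : ∀ q : Fin n × Edge d, Measurable fun ω => X ω q.1 q.2 := fun q =>
    (measurable_pi_apply q.2).comp ((measurable_pi_apply q.1).comp hXm)
  set T : Finset (Fin n × Edge d) := Finset.univ.filter fun q => q.1 = i with hT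
  set T' : Finset (Fin n × Edge d) := Finset.univ.filter fun q => q.1 ≠ i with hT'
  have hdisj : Disjoint T T' := Finset.disjoint_filter_filter_not _ _ _
  have h := hX.indep.indepFun_finset T T' hdisj hm
  have hXX : IndepFun (fun ω => X ω i) (fun ω (j : {j : Fin n // j ≠ i}) => X ω j) μ :=
    h.comp (φ := fun (x : T → ℕ) (e : Edge d) => x ⟨(i, e), by simp [hT]⟩)
      (ψ := fun (x : T' → ℕ) (j : {j : Fin n // j ≠ i}) (e : Edge d) =>
        x ⟨(j, e), by simp [hT', j.2]⟩)
      (measurable_pi_lambda _ fun _ => measurable_pi_apply _)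
      (measurable_pi_lambda _ fun _ => measurable_pi_lambda _ fun _ => measurable_pi_apply _)
  have hXi : Measurable fun ω => X ω i := (measurable_pi_apply i).comp hXm
  have hXo : Measurable fun ω (j : {j : Fin n // j ≠ i}) => X ω j :=
    measurable_pi_lambda _ fun j => (measurable_pi_apply _).comp hXm
  refine indepFun_prodMk_of_indepFun hXi hXo hU ?_ hXX
  exact hUX.comp (φ := id) (ψ := fun x : Fin n → Network d =>
    (x i, fun j : {j : Fin n // j ≠ i} => x j)) measurable_id (by fun_prop)

lemma measurable_run {S : Type*} [MeasurableSpace S] {A : InitAlgorithm S n d K}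
    (hA : ∀ i, Measurable (Function.uncurry (A i))) {U : Ω → S} (hU : Measurable U)
    (hX : Measurable X) (i : Fin n) : Measurable fun ω => A.run (U ω) (X ω) i := by
  have hXo : Measurable fun ω (j : {j : Fin n // j ≠ i}) => X ω j :=
    measurable_pi_lambda _ fun j => (measurable_pi_apply _).comp hX
  exact (hA i).comp (hU.prodMk hXo)

/-- The probability that the test of layer `i` fails while the noise in the other layers is small:
given the other layers, this is a likelihood ratio test with fixed plug-in intensities. -/
lemma IsMMPBM.measureReal_testFails_le (hX : IsMMPBM p X μ) {S : Type*} [MeasurableSpace S]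
    {U : Ω → S} (hU : Measurable U) (hUX : IndepFun U X μ) {A : InitAlgorithm S n d K}
    (hA : ∀ i, Measurable (Function.uncurry (A i))) {θ₀ α β γ ησ ηz s κ δ : ℝ}
    (hp : p.InSpace θ₀ α β γ) (hθ : 0 < θ₀) (hα : 1 ≤ α) (hβ : 1 ≤ β) (hγ : 1 ≤ γ)
    (hn : 0 < n) (hd : 0 < d) (hK : 0 < K) (hs0 : 0 ≤ s) (hησ0 : 0 ≤ ησ)
    (hησ : 2 * β * (K * ησ) ≤ 1) (hηz : 4 * α * ηz ≤ 1)
    (hrel : relError α β γ s ησ ηz K ≤ 1 / 2)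
    (hκ : d ^ 2 * θ₀ * (relError α β γ s ησ ηz K ^ 2 + 8 * γ ^ 2 * ησ) ≤ κ * p.signal)
    (hδ : 0 < δ) (hδ1 : δ ≤ 1) (i : Fin n) :
    μ.real {ω | TestFails p ηz ησ i (A.run (U ω) (X ω) i) (X ω)} ≤
      4 * Real.exp (-((1 - δ) / 2) * p.signal + (1 + 4 / δ) * (2 * κ) * p.signal) +
        μ.real {ω | ¬ NoiseGood p ησ ηz (s * (n * d ^ 2 * θ₀ / K ^ 2)) i (X ω)} := by
  set u := s * (n * d ^ 2 * θ₀ / K ^ 2) with hu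
  set b := Real.exp (-((1 - δ) / 2) * p.signal + (1 + 4 / δ) * (2 * κ) * p.signal) with hb
  set R : Ω → InitOutput n d K i × ({j : Fin n // j ≠ i} → Network d) := fun ω =>
    (A.run (U ω) (X ω) i, fun j => X ω j) with hR
  set M : Set (Network d × (InitOutput n d K i × ({j : Fin n // j ≠ i} → Network d))) :=
    {q | NoiseGood p ησ ηz u i (insertLayer i q.1 q.2.2) ∧
      TestFails p ηz ησ i q.2.1 (insertLayer i q.1 q.2.2)} with hM
  have hXm := hX.meas
  have hXi : Measurable fun ω => X ω i := (measurable_pi_apply i).comp hXm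
  have hXo : Measurable fun ω (j : {j : Fin n // j ≠ i}) => X ω j :=
    measurable_pi_lambda _ fun j => (measurable_pi_apply _).comp hXm
  have hRm : Measurable R := (measurable_run hA hU hXm i).prodMk hXo
  have hind : IndepFun (fun ω => X ω i) R μ :=
    (hX.indepFun_layer hU hUX i).comp (φ := id)
      (ψ := fun q : S × ({j : Fin n // j ≠ i} → Network d) => (A i q.1 q.2, q.2))
      measurable_id ((hA i).prodMk measurable_snd)
  have hfix : ∀ r, μ {ω | (X ω i, r) ∈ M} ≤ ENNReal.ofReal (4 * b) := by
    rintro ⟨w, y⟩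
    set Y := insertLayer i 0 y with hY
    set F : Equiv.Perm (Fin 2) → Fin 2 → Set Ω := fun π m =>
      {ω | (NoiseGood p ησ ηz u i Y ∧ AccurateUnder p ηz ησ i w π ∧ m ≠ p.z i) ∧
        ∑ e, logLik (Phat Y i w (π (p.z i)) e) (X ω i e) ≤
          ∑ e, logLik (Phat Y i w (π m) e) (X ω i e)} with hF
    have hsub : {ω | (X ω i, (w, y)) ∈ M} ⊆ ⋃ π, ⋃ m, F π m := by
      rintro ω ⟨hgood, π, hπ, m, hm, hscore⟩
      simp only [Set.mem_iUnion]
      refine ⟨π, m, ⟨hgood.congr fun j hj => insertLayer_of_ne _ _ _ hj, hπ, hm⟩, ?_⟩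
      have hP : ∀ m e, Phat (insertLayer i (X ω i) y) i w m e = Phat Y i w m e := fun m e =>
        Phat_congr w (fun j hj => insertLayer_of_ne _ _ _ hj) m e
      simpa only [score, insertLayer_self, hP] using hscore
    have hFle : ∀ π m, μ.real (F π m) ≤ b := by
      intro π m
      by_cases h : NoiseGood p ησ ηz u i Y ∧ AccurateUnder p ηz ησ i w π ∧ m ≠ p.z i
      · obtain ⟨hgood, hacc, hm⟩ := h
        have hbd := fun m => Phat_bounds hp hθ hα hβ hγ hn hd hK hs0 hησ0 hησ hηz hrel hgood
          hacc.1 (hacc.2 m)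
        refine (measureReal_mono fun ω hω => hω.2).trans
          (hX.measureReal_test_le hp hθ hδ hδ1 i hm (hbd _).1 (hbd _).1 (κ := κ) ?_ ?_)
        · exact (hbd _).2.trans (by gcongr)
        · exact (hbd _).2.trans (by gcongr)
      · have : F π m = ∅ := by
          ext ω
          simp only [hF, Set.mem_ofPred_eq, h, false_and, Set.mem_empty_iff_false]
        rw [this, measureReal_empty]
        exact (Real.exp_pos _).le
    have hreal : μ.real {ω | (X ω i, (w, y)) ∈ M} ≤ 4 * b := by
      refine (measureReal_mono hsub).trans ((measureReal_iUnion_fintype_le _).trans ?_)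
      calc ∑ π, μ.real (⋃ m, F π m) ≤ ∑ _π : Equiv.Perm (Fin 2), 2 * b := by
            refine Finset.sum_le_sum fun π _ => (measureReal_iUnion_fintype_le _).trans ?_
            rw [Fin.sum_univ_two]
            linarith [hFle π 0, hFle π 1]
        _ = 4 * b := by
            rw [Finset.sum_const, Finset.card_univ, Fintype.card_perm, Fintype.card_fin]
            simp
            ring
    rw [← ofReal_measureReal]
    exact ENNReal.ofReal_le_ofReal hreal
  have hjoint := measure_le_of_indepFun hXi hRm hind (M := M) (Set.to_countable M).measurableSet
    hfix
  have hjoint' : μ.real {ω | (X ω i, R ω) ∈ M} ≤ 4 * b :=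
    ENNReal.toReal_le_of_le_ofReal (by positivity) hjoint
  refine (measureReal_mono (s₂ := {ω | (X ω i, R ω) ∈ M} ∪
    {ω | ¬ NoiseGood p ησ ηz u i (X ω)}) ?_).trans ((measureReal_union_le _ _).trans
      (add_le_add hjoint' le_rfl))
  intro ω hω
  by_cases hg : NoiseGood p ησ ηz u i (X ω)
  · refine Or.inl ⟨?_, ?_⟩
    · rw [insertLayer_restrict]
      exact hg
    · rw [insertLayer_restrict]
      exact hω
  · exact Or.inr hg

lemma measurableSet_testFails {S : Type*} [MeasurableSpace S] {A : InitAlgorithm S n d K}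
    (hA : ∀ i, Measurable (Function.uncurry (A i))) {U : Ω → S} (hU : Measurable U)
    (hX : Measurable X) (ηz ησ : ℝ) (i : Fin n) :
    MeasurableSet {ω | TestFails p ηz ησ i (A.run (U ω) (X ω) i) (X ω)} :=
  ((measurable_run hA hU hX i).prodMk hX)
    (Set.to_countable {q : InitOutput n d K i × (Fin n → Network d) |
      TestFails p ηz ησ i q.1 q.2}).measurableSet

lemma measurableSet_initAccurate {S : Type*} [MeasurableSpace S] {A : InitAlgorithm S n d K}
    (hA : ∀ i, Measurable (Function.uncurry (A i))) {U : Ω → S} (hU : Measurable U)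
    (hX : Measurable X) (ηz ησ : ℝ) :
    MeasurableSet {ω | ∀ i, InitAccurate p ηz ησ i (A.run (U ω) (X ω) i)} := by
  have h : {ω | ∀ i, InitAccurate p ηz ησ i (A.run (U ω) (X ω) i)} =
      ⋂ i, {ω | InitAccurate p ηz ησ i (A.run (U ω) (X ω) i)} := by
    ext ω
    simp
  rw [h]
  exact MeasurableSet.iInter fun i => measurable_run hA hU hX i
    (Set.to_countable {w : InitOutput n d K i | InitAccurate p ηz ησ i w}).measurableSet

lemma integrable_clusterError {ν : Measure Ω} [IsFiniteMeasure ν] {zhat : Ω → Fin n → Fin 2}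
    (hz : Measurable zhat) (z : Fin n → Fin 2) :
    Integrable (fun ω => clusterError (zhat ω) z) ν := by
  refine Integrable.of_bound (C := 1) (Measurable.aestronglyMeasurable
    ((measurable_of_countable fun x : Fin n → Fin 2 => clusterError x z).comp hz)) ?_
  refine ae_of_all _ fun ω => ?_
  rw [Real.norm_eq_abs, abs_of_nonneg (clusterError_nonneg _ _)]
  exact clusterError_le_one _ _

/-- On the event that all initializations are accurate, the expected error is at most the largest
failure probability of the tests. -/
lemma setIntegral_clusterError_le {S : Type*} [MeasurableSpace S] {A : InitAlgorithm S n d K}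
    (hA : ∀ i, Measurable (Function.uncurry (A i))) {U : Ω → S} (hU : Measurable U)
    (hX : Measurable X) {θ₀ α β γ ηz ησ b : ℝ}
    (hp : p.InSpace θ₀ α β γ) (hα : 1 ≤ α) (hηz : 8 * α * ηz < 1) (hn : 0 < n)
    {zhat : Ω → Fin n → Fin 2} (hz : Measurable zhat)
    (hout : ∀ ω, IsTwoStageOutput (X ω) (A.run (U ω) (X ω)) (zhat ω))
    (hb : ∀ i, μ.real {ω | TestFails p ηz ησ i (A.run (U ω) (X ω) i) (X ω)} ≤ b) :
    ∫ ω in {ω | ∀ i, InitAccurate p ηz ησ i (A.run (U ω) (X ω) i)},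
      clusterError (zhat ω) p.z ∂μ ≤ b := by
  classical
  have hn' : (0 : ℝ) < n := by exact_mod_cast hn
  have hG := measurableSet_initAccurate (p := p) hA hU hX ηz ησ
  set T : Fin n → Set Ω := fun i => {ω | TestFails p ηz ησ i (A.run (U ω) (X ω) i) (X ω)} with hT
  have hTm : ∀ i, MeasurableSet (T i) := fun i => measurableSet_testFails hA hU hX ηz ησ i
  have hTi : ∀ i, Integrable ((T i).indicator fun _ => (1 : ℝ)) μ := fun i =>
    (integrable_const 1).indicator (hTm i)
  rw [← integral_indicator hG]
  calc _ ≤ ∫ ω, (∑ i, (T i).indicator (fun _ => (1 : ℝ)) ω) / n ∂μ := by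
        refine integral_mono ((integrable_clusterError hz p.z).indicator hG)
          ((integrable_finsetSum _ fun i _ => hTi i).div_const _) fun ω => ?_
        by_cases hω : ω ∈ {ω | ∀ i, InitAccurate p ηz ησ i (A.run (U ω) (X ω) i)}
        · rw [Set.indicator_of_mem hω]
          refine (clusterError_le_card_testFails hp hα hηz hn (hout ω) hω).trans_eq ?_
          rw [Finset.card_filter]
          push_cast
          congr 1
        · rw [Set.indicator_of_notMem hω]
          exact div_nonneg (Finset.sum_nonneg fun i _ => Set.indicator_nonneg (by simp) _) hn'.le
    _ = (∑ i, μ.real (T i)) / n := by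
        rw [integral_div, integral_finsetSum _ fun i _ => hTi i]
        simp only [integral_indicator (hTm _), integral_const, smul_eq_mul, mul_one,
          measureReal_restrict_apply_univ]
    _ ≤ b := by
        rw [div_le_iff₀ hn']
        refine (Finset.sum_le_card_nsmul _ _ _ fun i _ => hb i).trans_eq ?_
        simp
        ring

end Layer

/-! ### Choice of the noise level -/

/-- The quantitative form of the assumptions of the theorem, with `c` in place of the `o(1)`
factors. -/
structure Regime (c : ℝ) (n d K : ℕ) (θ₀ I ησ ηz : ℝ) : Prop where
  d_pos : 0 < d
  K_pos : 0 < K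
  θ_pos : 0 < θ₀
  ησ_nonneg : 0 ≤ ησ
  ηz_pos : 0 < ηz
  one_le_signal : 1 ≤ I
  one_le_log : 1 ≤ Real.log n
  entropy : ησ * Real.log (1 / ησ) ≤
    c * (I ^ 2 / ((K : ℝ) ^ 2 * (d : ℝ) ^ 2 * θ₀ * ((d : ℝ) / n)))
  error : max ησ ηz ≤ c * (I / ((K : ℝ) ^ 2 * (d : ℝ) ^ 2 * θ₀))
  layers : (K : ℝ) ^ 2 * Real.log n ≤ c * n

lemma Regime.n_pos {c : ℝ} {n d K : ℕ} {θ₀ I ησ ηz : ℝ} (h : Regime c n d K θ₀ I ησ ηz) :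
    0 < n := by
  rcases Nat.eq_zero_or_pos n with h0 | h0
  · have := h.one_le_log
    simp [h0] at this
    linarith
  · exact h0

/-- Both initial error rates are `O(c I / (K² d² θ₀))`. -/
lemma Regime.error_mul_le {c : ℝ} {n d K : ℕ} {θ₀ I ησ ηz : ℝ} (h : Regime c n d K θ₀ I ησ ηz) :
    (K : ℝ) ^ 2 * ησ * (d ^ 2 * θ₀) ≤ c * I ∧ (K : ℝ) ^ 2 * ηz * (d ^ 2 * θ₀) ≤ c * I := by
  have hd : (0 : ℝ) < d := by exact_mod_cast h.d_pos
  have hK : (0 : ℝ) < K := by exact_mod_cast h.K_pos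
  have hθ := h.θ_pos
  have hpos : 0 < (K : ℝ) ^ 2 * d ^ 2 * θ₀ := by positivity
  have he := h.error
  rw [← mul_div_assoc, le_div_iff₀ hpos] at he
  have h1 := mul_le_mul_of_nonneg_right (le_max_left ησ ηz) hpos.le
  have h2 := mul_le_mul_of_nonneg_right (le_max_right ησ ηz) hpos.le
  constructor <;> linarith

lemma Regime.entropy_mul_le {c γ : ℝ} {n d K : ℕ} {θ₀ I ησ ηz : ℝ}
    (h : Regime c n d K θ₀ I ησ ηz) (hc : 0 ≤ c) (hI : I ≤ γ * (d ^ 2 * θ₀)) :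
    d * (ησ * Real.log (1 / ησ)) ≤ c * γ * ((n : ℝ) / K ^ 2 * I) := by
  have hd : (0 : ℝ) < d := by exact_mod_cast h.d_pos
  have hK : (0 : ℝ) < K := by exact_mod_cast h.K_pos
  have hn : (0 : ℝ) < n := by exact_mod_cast h.n_pos
  have hθ := h.θ_pos
  have hI1 := h.one_le_signal
  calc d * (ησ * Real.log (1 / ησ))
      ≤ d * (c * (I ^ 2 / ((K : ℝ) ^ 2 * (d : ℝ) ^ 2 * θ₀ * ((d : ℝ) / n)))) := by
        have := h.entropy
        gcongr
    _ = c * (n / K ^ 2 * I) * (I / (d ^ 2 * θ₀)) := by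
        field_simp
    _ ≤ c * (n / K ^ 2 * I) * γ := by
        have : I / (d ^ 2 * θ₀) ≤ γ := by rwa [div_le_iff₀ (by positivity)]
        gcongr
    _ = _ := by ring

/-- The relative noise level `s = √(κ I / T)` is large enough for `s T` to dominate `I`. -/
lemma signal_le_noise_mul {γ κ T I s : ℝ} (hγ : 1 ≤ γ) (hκ : 0 < κ) (hκγ : κ * γ ≤ 1)
    (hT : 0 < T) (hI0 : 0 ≤ I) (hs : 0 ≤ s) (hsT : s ^ 2 * T = κ * I) (hI : I ≤ γ * T) :
    κ / γ * I ≤ s * T := by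
  have h1 : (κ / γ * I) ^ 2 ≤ (s * T) ^ 2 := by
    have e1 : (s * T) ^ 2 = κ * I * T := by
      rw [mul_pow, sq T, ← mul_assoc, hsT]
    have h2 : I / γ ≤ T := by rwa [div_le_iff₀' (by positivity)]
    have h3 : κ / γ ≤ κ := div_le_self hκ.le hγ
    have h4 : κ ≤ 1 := (le_mul_of_one_le_right hκ.le hγ).trans hκγ
    have h5 : κ / γ ≤ 1 := h3.trans h4
    rw [e1]
    calc (κ / γ * I) ^ 2 = κ * (κ / γ) * I * (I / γ) := by ring
      _ ≤ κ * 1 * I * T := by gcongr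
      _ = κ * I * T := by ring
  exact (abs_le_of_sq_le_sq' h1 (by positivity)).2

/-- The Chernoff exponent, at `log (1 / η) / 2`, of a Poisson variable of mean at most `η a N`
at level `s N`. -/
lemma poisson_exponent_le {a η s N : ℝ} (ha : 0 ≤ a) (hη : 0 < η) (hη2 : 2 ≤ Real.log (1 / η))
    (hs : 0 ≤ s) (hN : 0 ≤ N) (hηs : η * (16 * a ^ 2) ≤ s ^ 2) :
    -(1 / 2 * Real.log (1 / η) * (s * N)) +
      η * (a * N) * (Real.exp (1 / 2 * Real.log (1 / η)) - 1) ≤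
      -(3 / 8 * (Real.log (1 / η) * (s * N))) := by
  have hsqrt : √η * a ≤ s / 4 := by
    have h1 : (√η * a) ^ 2 ≤ (s / 4) ^ 2 := by
      rw [mul_pow, Real.sq_sqrt hη.le]
      linarith
    exact (abs_le_of_sq_le_sq' h1 (by positivity)).2
  have hexp : η * Real.exp (1 / 2 * Real.log (1 / η)) = √η := by
    have h1 : Real.exp (1 / 2 * Real.log (1 / η)) = (√η)⁻¹ := by
      rw [← Real.sqrt_inv, one_div η, one_div_mul_eq_div, Real.exp_half,
        Real.exp_log (inv_pos.2 hη)]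
    have h2 : 0 < √η := Real.sqrt_pos.2 hη
    rw [h1, ← div_eq_mul_inv, div_eq_iff h2.ne', Real.mul_self_sqrt hη.le]
  have h1 : η * (a * N) * (Real.exp (1 / 2 * Real.log (1 / η)) - 1) ≤ √η * a * N := by
    have h2 : 0 ≤ η * (a * N) := by positivity
    calc η * (a * N) * (Real.exp (1 / 2 * Real.log (1 / η)) - 1)
        ≤ η * (a * N) * Real.exp (1 / 2 * Real.log (1 / η)) := by gcongr; linarith
      _ = η * Real.exp (1 / 2 * Real.log (1 / η)) * a * N := by ring
      _ = _ := by rw [hexp]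
  have h2 : √η * a * N ≤ s / 4 * N := by gcongr
  have h3 : 2 * (s * N) ≤ Real.log (1 / η) * (s * N) := by gcongr
  linarith

lemma four_le_exp_two : (4 : ℝ) ≤ Real.exp 2 := by
  have h1 : (2 : ℝ) ≤ Real.exp 1 := by linarith [Real.add_one_le_exp (1 : ℝ)]
  have h2 : Real.exp 2 = Real.exp 1 * Real.exp 1 := by rw [← Real.exp_add]; norm_num
  nlinarith

/-- Comparison of all exponents in the union bound for the noise event. The number `N₁` counts the
pairs of communities, `N₂` the community assignments and `N₃` the sets of mislabelled layers. -/
lemma union_exponents_le {y I x u v N₁ N₂ N₃ E₁ E₂ : ℝ} (hN₂0 : 0 ≤ N₂) (hN₃0 : 0 ≤ N₃)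
    (hI1 : 1 ≤ I) (hIy : I ≤ y)
    (hN₁ : N₁ ≤ Real.exp y) (hN₂ : N₂ ≤ Real.exp (2 * y)) (hN₃ : N₃ ≤ Real.exp v)
    (hE₁ : E₁ ≤ -x) (hE₂ : v + E₂ ≤ -u) (hx : 7 * y ≤ x) (hu : 7 * y ≤ u) :
    2 * N₁ * N₂ * (2 * Real.exp E₁ + N₃ * Real.exp E₂) ≤ Real.exp (-I) := by
  have he1 : (2 : ℝ) ≤ Real.exp 1 := by linarith [Real.add_one_le_exp (1 : ℝ)]
  have he2 := four_le_exp_two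
  have hexp1 : Real.exp E₁ ≤ Real.exp (-(7 * y)) := Real.exp_le_exp.2 (by linarith)
  have hexp2 : N₃ * Real.exp E₂ ≤ Real.exp (-(7 * y)) := by
    calc N₃ * Real.exp E₂ ≤ Real.exp v * Real.exp E₂ := by gcongr
      _ = Real.exp (v + E₂) := (Real.exp_add _ _).symm
      _ ≤ _ := Real.exp_le_exp.2 (by linarith)
  calc 2 * N₁ * N₂ * (2 * Real.exp E₁ + N₃ * Real.exp E₂)
      ≤ 2 * Real.exp y * Real.exp (2 * y) *
          (2 * Real.exp (-(7 * y)) + Real.exp (-(7 * y))) := by gcongr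
    _ ≤ Real.exp 1 * Real.exp 2 * Real.exp y * Real.exp (2 * y) * Real.exp (-(7 * y)) := by
        have h1 : 0 < Real.exp y * Real.exp (2 * y) * Real.exp (-(7 * y)) := by positivity
        have h2 : 6 ≤ Real.exp 1 * Real.exp 2 := by nlinarith
        nlinarith
    _ = Real.exp (1 + 2 + y + 2 * y + -(7 * y)) := by simp only [Real.exp_add]
    _ ≤ Real.exp (-I) := Real.exp_le_exp.2 (by linarith)

/-- With relative noise level `s = √(κ I / (d² θ₀))`, the noise event fails with probability at
most `exp (-I)`. -/
lemma Regime.noise_le {a γ κ c : ℝ} (hγa : γ ≤ a) (hγ : 1 ≤ γ) (hκ : 0 < κ)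
    (hκγ : κ * γ ≤ 1) (hc : 0 < c) (hc1 : c * (28 * γ * a) ≤ κ) (hc2 : c * (16 * a ^ 2) ≤ κ)
    {n d K : ℕ} {θ₀ I ησ ηz : ℝ} (h : Regime c n d K θ₀ I ησ ηz)
    (hηz : ηz ≤ Real.exp (-2)) (hI : I ≤ γ * (d ^ 2 * θ₀)) :
    ∃ s t t' : ℝ, 0 ≤ s ∧ s ^ 2 * (d ^ 2 * θ₀) = κ * I ∧ 0 ≤ t ∧ t ≤ 1 ∧ 0 < t' ∧
      2 * K ^ 2 * Real.exp (2 * (d * (ησ * Real.log (1 / ησ)))) *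
        (2 * Real.exp (-(t * (s * (n * d ^ 2 * θ₀ / K ^ 2))) +
          a * (n * d ^ 2 * θ₀ / K ^ 2) * t ^ 2) +
        Real.exp (2 * (n * (ηz * Real.log (1 / ηz)))) *
          Real.exp (-(t' * (s * (n * d ^ 2 * θ₀ / K ^ 2))) +
            ηz * (a * (n * d ^ 2 * θ₀ / K ^ 2)) * (Real.exp t' - 1))) ≤ Real.exp (-I) := by
  have hd : (0 : ℝ) < d := by exact_mod_cast h.d_pos
  have hK : (0 : ℝ) < K := by exact_mod_cast h.K_pos
  have hK1 : (1 : ℝ) ≤ K := by exact_mod_cast h.K_pos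
  have hn : (0 : ℝ) < n := by exact_mod_cast h.n_pos
  have hθ := h.θ_pos
  have hI1 := h.one_le_signal
  have hlog := h.one_le_log
  have hηz0 := h.ηz_pos
  have hent := h.entropy_mul_le hc.le hI
  have herr := h.error_mul_le.2
  have hlay := h.layers
  have ha : 1 ≤ a := hγ.trans hγa
  have hN : (n : ℝ) * d ^ 2 * θ₀ / K ^ 2 = n / K ^ 2 * (d ^ 2 * θ₀) := by ring
  have hT0 : (0 : ℝ) < d ^ 2 * θ₀ := by positivity
  have hq0 : (0 : ℝ) < n / K ^ 2 := by positivity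
  have hcq : Real.log n ≤ c * (n / K ^ 2) := by
    rw [← mul_div_assoc, le_div_iff₀ (by positivity)]
    linarith
  have hηzT : n * ηz * (d ^ 2 * θ₀) ≤ c * (n / K ^ 2) * I := by
    have e : c * (n / K ^ 2) * I = n * (c * I) / K ^ 2 := by ring
    rw [e, le_div_iff₀ (by positivity)]
    calc n * ηz * (d ^ 2 * θ₀) * K ^ 2 = n * (K ^ 2 * ηz * (d ^ 2 * θ₀)) := by ring
      _ ≤ _ := by gcongr
  have hηzT' : ηz * (d ^ 2 * θ₀) ≤ c * I := by
    refine le_trans ?_ herr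
    rw [mul_assoc]
    exact le_mul_of_one_le_left (by positivity) (one_le_pow₀ hK1)
  have hκ1 : κ ≤ 1 := (le_mul_of_one_le_right hκ.le hγ).trans hκγ
  have hc_le : c ≤ 1 := by
    have h1 : 1 ≤ 28 * γ * a := one_le_mul_of_one_le_of_one_le (by linarith) ha
    exact (le_mul_of_one_le_right hc.le h1).trans (hc1.trans hκ1)
  rw [hN]
  generalize (d : ℝ) ^ 2 * θ₀ = T at *
  have hK2 : (K : ℝ) ^ 2 ≤ Real.exp (Real.log n) := by
    rw [Real.exp_log hn]
    calc (K : ℝ) ^ 2 = (K : ℝ) ^ 2 * 1 := (mul_one _).symm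
      _ ≤ (K : ℝ) ^ 2 * Real.log n := by gcongr
      _ ≤ c * n := hlay
      _ ≤ 1 * n := by gcongr
      _ = n := one_mul _
  generalize (n : ℝ) / (K : ℝ) ^ 2 = q at *
  have hLz2 : 2 ≤ Real.log (1 / ηz) := by
    rw [one_div, Real.log_inv]
    have := Real.log_le_log hηz0 hηz
    rw [Real.log_exp] at this
    linarith
  obtain ⟨s, hs0, hs2⟩ : ∃ s : ℝ, 0 ≤ s ∧ s ^ 2 = κ * I / T :=
    ⟨√(κ * I / T), Real.sqrt_nonneg _, Real.sq_sqrt (by positivity)⟩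
  have hsT : s ^ 2 * T = κ * I := by
    rw [hs2]
    field_simp
  have hs1 : s ≤ 1 := by
    refine (sq_le_one_iff₀ hs0).1 ?_
    rw [hs2, div_le_one hT0]
    calc κ * I ≤ κ * (γ * T) := by gcongr
      _ = κ * γ * T := by ring
      _ ≤ 1 * T := by gcongr
      _ = T := one_mul T
  have hqI : q ≤ q * I := le_mul_of_one_le_right hq0.le hI1
  have hsTI := signal_le_noise_mul hγ hκ hκγ hT0 (by linarith) hs0 hsT hI
  -- `c γ q I` dominates the entropies and `I` itself, and is dominated by both Chernoff exponents
  have hcγ : c * (q * I) ≤ c * γ * (q * I) := by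
    have : c ≤ c * γ := le_mul_of_one_le_right hc.le hγ
    gcongr
  have hcq1 : c * q ≤ c * γ * (q * I) := le_trans (by gcongr) hcγ
  have hIy : I ≤ c * γ * (q * I) := by
    refine le_trans ?_ hcγ
    rw [← mul_assoc]
    exact le_mul_of_one_le_left (by linarith) (hlog.trans hcq)
  have hu_low : κ / γ * (q * I) ≤ s * (q * T) := by
    calc κ / γ * (q * I) = q * (κ / γ * I) := by ring
      _ ≤ q * (s * T) := by gcongr
      _ = _ := by ring
  have hu28 : 28 * (c * γ * (q * I)) ≤ s * (q * T) := by
    refine le_trans ?_ hu_low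
    rw [div_mul_eq_mul_div, le_div_iff₀ (by positivity)]
    calc 28 * (c * γ * (q * I)) * γ = c * (28 * γ * γ) * (q * I) := by ring
      _ ≤ c * (28 * γ * a) * (q * I) := by gcongr
      _ ≤ κ * (q * I) := by gcongr
  have hnηz : n * ηz ≤ c * γ * (q * I) := by
    have h1 : n * ηz ≤ c * γ * q := by
      refine le_of_mul_le_mul_right ?_ hT0
      calc n * ηz * T ≤ c * q * I := hηzT
        _ ≤ c * q * (γ * T) := by gcongr
        _ = _ := by ring
    exact h1.trans (by gcongr)
  have hηs : ηz * (16 * a ^ 2) ≤ s ^ 2 := by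
    refine le_of_mul_le_mul_right ?_ hT0
    rw [hsT]
    calc ηz * (16 * a ^ 2) * T = 16 * a ^ 2 * (ηz * T) := by ring
      _ ≤ 16 * a ^ 2 * (c * I) := by gcongr
      _ = c * (16 * a ^ 2) * I := by ring
      _ ≤ κ * I := by gcongr
  have hE2 := poisson_exponent_le (a := a) (N := q * T) (by linarith) hηz0 hLz2 hs0
    (by positivity) hηs
  have hLu : 2 * (s * (q * T)) ≤ Real.log (1 / ηz) * (s * (q * T)) := by gcongr
  have hent2 : 16 * (n * ηz) * Real.log (1 / ηz) ≤ Real.log (1 / ηz) * (s * (q * T)) := by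
    have h1 : 16 * (n * ηz) ≤ s * (q * T) := by linarith
    rw [mul_comm]
    exact mul_le_mul_of_nonneg_left h1 (by linarith)
  have hE1 : -(s / (2 * a) * (s * (q * T))) + a * (q * T) * (s / (2 * a)) ^ 2 =
      -(κ * (q * I) / (4 * a)) := by
    have : -(s / (2 * a) * (s * (q * T))) + a * (q * T) * (s / (2 * a)) ^ 2 =
        -(s ^ 2 * T * q / (4 * a)) := by
      field_simp
      ring
    rw [this, hsT]
    ring
  have hE1' : 7 * (c * γ * (q * I)) ≤ κ * (q * I) / (4 * a) := by
    rw [le_div_iff₀ (by positivity)]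
    calc 7 * (c * γ * (q * I)) * (4 * a) = c * (28 * γ * a) * (q * I) := by ring
      _ ≤ κ * (q * I) := by gcongr
  refine ⟨s, s / (2 * a), 1 / 2 * Real.log (1 / ηz), hs0, hsT, by positivity, ?_, by linarith,
    union_exponents_le (y := c * γ * (q * I)) (x := κ * (q * I) / (4 * a))
      (u := 7 * (c * γ * (q * I))) (v := 2 * (n * (ηz * Real.log (1 / ηz))))
      (Real.exp_pos _).le (Real.exp_pos _).le hI1 hIy (hK2.trans (Real.exp_le_exp.2 (hcq.trans hcq1)))
      (Real.exp_le_exp.2 (by linarith)) le_rfl hE1.le ?_ hE1' le_rfl⟩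
  · rw [div_le_one (by positivity)]
    linarith
  · linarith

/-- The mean square error of the estimated intensities is a small multiple of `I θ₀`. -/
lemma Regime.relError_le {α β γ κ κ₂ c s : ℝ} (hγ : 1 ≤ γ) (hc : 0 < c) (hκ₂ : κ₂ * γ ≤ 1 / 4)
    (hκ : κ * (3 * (64 * α * β ^ 2) ^ 2) ≤ κ₂ / 2)
    (hc1 : c * (3 * (256 * α * β ^ 3 * γ) ^ 2 + 3 * (4 * α * γ) ^ 2 + 8 * γ ^ 2) ≤ κ₂ / 2)
    {n d K : ℕ} {θ₀ I ησ ηz : ℝ} (h : Regime c n d K θ₀ I ησ ηz) (hησ : ησ ≤ 1) (hηz : ηz ≤ 1)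
    (hI : I ≤ γ * (d ^ 2 * θ₀)) (hs : s ^ 2 * (d ^ 2 * θ₀) = κ * I) :
    relError α β γ s ησ ηz K ≤ 1 / 2 ∧
      d ^ 2 * θ₀ * (relError α β γ s ησ ηz K ^ 2 + 8 * γ ^ 2 * ησ) ≤ κ₂ * I := by
  have hd : (0 : ℝ) < d := by exact_mod_cast h.d_pos
  have hK : (1 : ℝ) ≤ K := by exact_mod_cast h.K_pos
  have hθ := h.θ_pos
  have hI1 := h.one_le_signal
  have hησ0 := h.ησ_nonneg
  have hηz0 := h.ηz_pos
  obtain ⟨hσ, hz⟩ := h.error_mul_le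
  set T : ℝ := d ^ 2 * θ₀ with hT
  have hT0 : 0 < T := by positivity
  set C₁ := 64 * α * β ^ 2 with hC₁
  set C₂ := 256 * α * β ^ 3 * γ with hC₂
  set C₃ := 4 * α * γ with hC₃
  have hρ : relError α β γ s ησ ηz K = C₁ * s + C₂ * (K * ησ) + C₃ * ηz := rfl
  set ρ := relError α β γ s ησ ηz K with hρdef
  have hK2 : (1 : ℝ) ≤ (K : ℝ) ^ 2 := one_le_pow₀ hK
  have h1 : (K * ησ) ^ 2 * T ≤ c * I := by
    calc (K * ησ) ^ 2 * T = ησ * ((K : ℝ) ^ 2 * ησ * T) := by ring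
      _ ≤ 1 * ((K : ℝ) ^ 2 * ησ * T) := by gcongr
      _ ≤ _ := by linarith
  have h2 : ηz * T ≤ c * I := by
    refine le_trans ?_ hz
    rw [mul_assoc]
    exact le_mul_of_one_le_left (by positivity) hK2
  have h3 : ησ * T ≤ c * I := by
    refine le_trans ?_ hσ
    rw [mul_assoc]
    exact le_mul_of_one_le_left (by positivity) hK2
  have h4 : ηz ^ 2 * T ≤ c * I := by
    calc ηz ^ 2 * T = ηz * (ηz * T) := by ring
      _ ≤ 1 * (ηz * T) := by gcongr
      _ ≤ _ := by linarith
  have hsq : ρ ^ 2 ≤ 3 * C₁ ^ 2 * s ^ 2 + 3 * C₂ ^ 2 * (K * ησ) ^ 2 + 3 * C₃ ^ 2 * ηz ^ 2 := by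
    rw [hρ]
    linarith [sq_nonneg (C₁ * s - C₂ * (K * ησ)), sq_nonneg (C₁ * s - C₃ * ηz),
      sq_nonneg (C₂ * (K * ησ) - C₃ * ηz)]
  have hmain : T * (ρ ^ 2 + 8 * γ ^ 2 * ησ) ≤ κ₂ * I := by
    calc T * (ρ ^ 2 + 8 * γ ^ 2 * ησ)
        ≤ T * (3 * C₁ ^ 2 * s ^ 2 + 3 * C₂ ^ 2 * (K * ησ) ^ 2 + 3 * C₃ ^ 2 * ηz ^ 2 +
            8 * γ ^ 2 * ησ) := by gcongr
      _ = 3 * C₁ ^ 2 * (s ^ 2 * T) + 3 * C₂ ^ 2 * ((K * ησ) ^ 2 * T) + 3 * C₃ ^ 2 * (ηz ^ 2 * T) +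
            8 * γ ^ 2 * (ησ * T) := by ring
      _ ≤ 3 * C₁ ^ 2 * (κ * I) + 3 * C₂ ^ 2 * (c * I) + 3 * C₃ ^ 2 * (c * I) +
            8 * γ ^ 2 * (c * I) := by
          rw [hs]
          gcongr
      _ = κ * (3 * C₁ ^ 2) * I + c * (3 * C₂ ^ 2 + 3 * C₃ ^ 2 + 8 * γ ^ 2) * I := by ring
      _ ≤ κ₂ / 2 * I + κ₂ / 2 * I := by gcongr
      _ = κ₂ * I := by ring
  refine ⟨?_, hmain⟩
  have hκ₂0 : 0 ≤ κ₂ := by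
    have : 0 ≤ c * (3 * C₂ ^ 2 + 3 * C₃ ^ 2 + 8 * γ ^ 2) := by positivity
    linarith
  have h5 : ρ ^ 2 * T ≤ (1 / 2) ^ 2 * T := by
    have h6 : κ₂ * I ≤ κ₂ * (γ * T) := by gcongr
    have h7 : κ₂ * γ * T ≤ 1 / 4 * T := by gcongr
    have h8 : 0 ≤ T * (8 * γ ^ 2 * ησ) := by positivity
    linarith
  exact (abs_le_of_sq_le_sq' (le_of_mul_le_mul_right h5 hT0) (by norm_num)).2

/-! ### The expected error for fixed sizes -/

lemma eventually_mul_le (M : ℝ) {b : ℝ} (hb : 0 < b) : ∀ᶠ x in 𝓝[>] (0 : ℝ), x * M ≤ b := by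
  have h : Tendsto (fun x : ℝ => x * M) (𝓝[>] 0) (𝓝 0) := by
    have : Tendsto (fun x : ℝ => x * M) (𝓝 0) (𝓝 (0 * M)) := tendsto_id.mul_const M
    rw [zero_mul] at this
    exact this.mono_left nhdsWithin_le_nhds
  exact h.eventually (eventually_le_nhds hb)

/-- The bounds for the test and for the noise event add up to the claimed rate. -/
lemma test_add_noise_le {ε δ κ I : ℝ} (hε1 : ε ≤ 1) (hδ : δ = ε / 4)
    (hκ : κ * ((1 + 4 / δ) * 2) ≤ ε / 8) (hI1 : 1 ≤ I) (hI : 8 ≤ ε * I) :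
    4 * Real.exp (-((1 - δ) / 2) * I + (1 + 4 / δ) * (2 * κ) * I) + Real.exp (-I) ≤
      Real.exp (-((1 - ε) * (I / 2))) := by
  have h1 : Real.exp (-((1 - δ) / 2) * I + (1 + 4 / δ) * (2 * κ) * I) ≤
      Real.exp (-((1 - ε) * (I / 2)) - 2) := by
    refine Real.exp_le_exp.2 ?_
    have h2 : (1 + 4 / δ) * (2 * κ) * I ≤ ε / 8 * I :=
      mul_le_mul_of_nonneg_right (by linarith) (by linarith)
    have h3 : -((1 - δ) / 2) * I = -(I / 2) + ε * I / 8 := by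
      rw [hδ]
      ring
    linarith
  have h2 : Real.exp (-I) ≤ Real.exp (-((1 - ε) * (I / 2)) - 2) := by
    refine Real.exp_le_exp.2 ?_
    have h3 : ε * I ≤ 1 * I := mul_le_mul_of_nonneg_right hε1 (by linarith)
    linarith
  have h3 : (5 : ℝ) ≤ Real.exp 2 := by
    have : Real.exp 2 = Real.exp 1 * Real.exp 1 := by rw [← Real.exp_add]; norm_num
    nlinarith [Real.exp_one_gt_d9]
  have h4 : Real.exp (-((1 - ε) * (I / 2))) =
      Real.exp (-((1 - ε) * (I / 2)) - 2) * Real.exp 2 := by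
    rw [← Real.exp_add]
    ring_nf
  rw [h4]
  have := mul_le_mul_of_nonneg_left h3 (Real.exp_pos (-((1 - ε) * (I / 2)) - 2)).le
  linarith

/-- The expected error on the accuracy event, in non-asymptotic form. -/
theorem exists_setIntegral_clusterError_le {α β γ ε : ℝ} (hα : 1 ≤ α) (hβ : 1 ≤ β) (hγ : 1 ≤ γ)
    (hε : 0 < ε) (hε1 : ε ≤ 1) :
    ∃ c : ℝ, 0 < c ∧ ∀ {n d K : ℕ} {θ₀ ησ ηz : ℝ} {p : Params n d K},
      p.InSpace θ₀ α β γ → Regime c n d K θ₀ p.signal ησ ηz → 1 / c ≤ p.signal →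
      ∀ {Ω S : Type*} [MeasurableSpace Ω] [MeasurableSpace S] {μ : Measure Ω}
        [IsProbabilityMeasure μ] {X : Ω → Fin n → Network d} {U : Ω → S}
        {A : InitAlgorithm S n d K} {zhat : Ω → Fin n → Fin 2},
      IsMMPBM p X μ → Measurable U → IndepFun U X μ →
      (∀ i, Measurable (Function.uncurry (A i))) → Measurable zhat →
      (∀ ω, IsTwoStageOutput (X ω) (A.run (U ω) (X ω)) (zhat ω)) →
      ∫ ω in {ω | ∀ i, InitAccurate p ηz ησ i (A.run (U ω) (X ω) i)},
        clusterError (zhat ω) p.z ∂μ ≤ Real.exp (-((1 - ε) * (p.signal / 2))) := by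
  set δ := ε / 4 with hδ
  have hδ0 : 0 < δ := by positivity
  have hδ1 : δ ≤ 1 := by rw [hδ]; linarith
  set a := 8 * β ^ 2 * γ with ha
  have hγa : γ ≤ a := by
    have : 1 ≤ β ^ 2 := one_le_pow₀ hβ
    rw [ha]
    exact le_mul_of_one_le_left (by linarith) (by linarith)
  -- the constants are fixed in the order `κ₂`, `κ`, `c`
  obtain ⟨κ₂, ⟨h1, h2⟩, hκ₂0 : 0 < κ₂⟩ := (((eventually_mul_le γ (b := 1 / 4) (by norm_num)).and
    (eventually_mul_le ((1 + 4 / δ) * 2) (b := ε / 8) (by positivity))).and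
      eventually_mem_nhdsWithin).exists
  obtain ⟨κ, ⟨h3, h4⟩, hκ0 : 0 < κ⟩ := (((eventually_mul_le γ (b := 1) one_pos).and
    (eventually_mul_le (3 * (64 * α * β ^ 2) ^ 2) (b := κ₂ / 2) (by positivity))).and
      eventually_mem_nhdsWithin).exists
  obtain ⟨c, ⟨h5, h6, h7, h8, h9, h10, h11⟩, hc0 : 0 < c⟩ :=
    (((eventually_mul_le (28 * γ * a) hκ0).and ((eventually_mul_le (16 * a ^ 2) hκ0).and
      ((eventually_mul_le (3 * (256 * α * β ^ 3 * γ) ^ 2 + 3 * (4 * α * γ) ^ 2 + 8 * γ ^ 2)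
        (b := κ₂ / 2) (by positivity)).and
      ((eventually_mul_le γ (Real.exp_pos (-2))).and
      ((eventually_mul_le (2 * β * γ) one_pos).and
      ((eventually_mul_le (8 * α * γ) (b := 1 / 2) (by norm_num)).and
        (eventually_mul_le 1 (b := ε / 8) (by positivity)))))))).and
      eventually_mem_nhdsWithin).exists
  refine ⟨c, hc0, ?_⟩
  intro n d K θ₀ ησ ηz p hp hreg hIc Ω S _ _ μ _ X U A zhat hX hU hUX hA hz hout
  have hn := hreg.n_pos
  have hd := hreg.d_pos
  have hK := hreg.K_pos
  have hθ := hreg.θ_pos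
  have hησ0 := hreg.ησ_nonneg
  have hηz0 := hreg.ηz_pos
  have hd' : (0 : ℝ) < d := by exact_mod_cast hd
  have hK' : (1 : ℝ) ≤ K := by exact_mod_cast hK
  have hI1 := hreg.one_le_signal
  have hI := hp.signal_le hθ hγ
  have hT : (0 : ℝ) < d ^ 2 * θ₀ := by positivity
  obtain ⟨hσ, hzz⟩ := hreg.error_mul_le
  have hcI : c * p.signal ≤ c * γ * (d ^ 2 * θ₀) := by
    rw [mul_assoc]
    gcongr
  have hσ' : (K : ℝ) ^ 2 * ησ ≤ c * γ := le_of_mul_le_mul_right (hσ.trans hcI) hT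
  have hz' : (K : ℝ) ^ 2 * ηz ≤ c * γ := le_of_mul_le_mul_right (hzz.trans hcI) hT
  have hKK : (K : ℝ) ≤ (K : ℝ) ^ 2 := le_self_pow₀ hK' two_ne_zero
  have hKσ : K * ησ ≤ c * γ := le_trans (by gcongr) hσ'
  have hησc : ησ ≤ c * γ := le_trans (le_mul_of_one_le_left hησ0 hK') hKσ
  have hηzc : ηz ≤ c * γ :=
    le_trans (le_mul_of_one_le_left hηz0.le (one_le_pow₀ hK')) hz'
  have he2 : Real.exp (-2) ≤ 1 / 4 := by
    rw [Real.exp_neg, one_div]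
    have := four_le_exp_two
    gcongr
  have hησ2 : 2 * β * (K * ησ) ≤ 1 := by
    calc 2 * β * (K * ησ) ≤ 2 * β * (c * γ) := by gcongr
      _ = c * (2 * β * γ) := by ring
      _ ≤ 1 := h9
  have hηz8 : 8 * α * ηz ≤ 1 / 2 := by
    calc 8 * α * ηz ≤ 8 * α * (c * γ) := by gcongr
      _ = c * (8 * α * γ) := by ring
      _ ≤ _ := h10
  obtain ⟨s, t, t', hs0, hs, ht0, ht1, ht'0, hnoise⟩ :=
    hreg.noise_le hγa hγ hκ0 h3 hc0 h5 h6 (hηzc.trans h8) hI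
  obtain ⟨hrel, hsq⟩ := hreg.relError_le (α := α) (β := β) hγ hc0 h1 h4 h7
    (by linarith) (by linarith) hI hs
  have hNσ : ∀ m, ((Finset.univ.filter fun r : Fin d → Fin K =>
      ((disagree r (p.σ m)).card : ℝ) ≤ ησ * d).card : ℝ) ≤
      Real.exp (2 * (d * (ησ * Real.log (1 / ησ)))) := fun m => by
    have : Nonempty (Fin K) := ⟨⟨0, hK⟩⟩
    have h := card_hammingBall_le (p.σ m) hησ0 (by rw [Fintype.card_fin]; linarith)
      (hησc.trans h8)
    simpa only [Fintype.card_fin] using h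
  have hNz : ((Finset.univ.filter fun r : Fin n → Bool =>
      ((disagree r fun _ => false).card : ℝ) ≤ ηz * n).card : ℝ) ≤
      Real.exp (2 * (n * (ηz * Real.log (1 / ηz)))) := by
    have h := card_hammingBall_le (fun _ : Fin n => false) hηz0.le
      (by rw [Fintype.card_bool]; push_cast; linarith) (hηzc.trans h8)
    simpa only [Fintype.card_fin] using h
  refine setIntegral_clusterError_le hA hU hX.meas hp hα (by linarith) hn hz hout fun i => ?_
  have htest := hX.measureReal_testFails_le hU hUX hA hp hθ hα hβ hγ hn hd hK hs0 hησ0 hησ2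
    (by linarith) hrel hsq hδ0 hδ1 i
  have hbad := (hX.measureReal_not_noiseGood_le (u := s * (n * d ^ 2 * θ₀ / K ^ 2)) hp hθ hβ hγ hK
    hησ2 i hNσ hNz ht0 ht1 ht'0).trans hnoise
  rw [div_le_iff₀ hc0] at hIc
  have hε8 : 8 ≤ ε * p.signal := by
    have := mul_le_mul_of_nonneg_right h11 (by linarith : 0 ≤ p.signal)
    linarith
  exact (htest.trans (add_le_add_right hbad _)).trans
    (test_add_noise_le hε1 rfl h2 hI1 hε8)

/-! ### Passage to the limit -/

/-- If `F ≤ exp (-(1 - ε) I / 2)` eventually for every `ε`, then `ε` can be replaced by a null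
sequence. -/
lemma exists_rate {F I : ℕ → ℝ} (hI : Tendsto I atTop atTop)
    (h : ∀ ε : ℝ, 0 < ε → ε ≤ 1 → ∀ᶠ t in atTop, F t ≤ Real.exp (-((1 - ε) * (I t / 2)))) :
    ∃ δ : ℕ → ℝ, Tendsto δ atTop (𝓝 0) ∧
      ∀ᶠ t in atTop, F t ≤ Real.exp (-((1 - δ t) * (I t / 2))) := by
  refine ⟨fun t => if F t ≤ 0 then 0 else max 0 (1 + 2 * Real.log (F t) / I t), ?_, ?_⟩
  · rw [Metric.tendsto_nhds]
    intro ε hε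
    have hε' : 0 < min (ε / 2) 1 := by positivity
    filter_upwards [h _ hε' (min_le_right _ _), hI.eventually_gt_atTop 0] with t ht hI0
    rw [Real.dist_eq, sub_zero]
    split_ifs with hF
    · simpa using hε
    · push Not at hF
      rw [abs_of_nonneg (le_max_left _ _)]
      refine max_lt hε ?_
      have h1 := Real.log_le_log hF ht
      rw [Real.log_exp] at h1
      have h2 : 2 * Real.log (F t) / I t ≤ -(1 - min (ε / 2) 1) := by
        rw [div_le_iff₀ hI0]
        linarith
      linarith [min_le_left (ε / 2) 1]
  · filter_upwards [hI.eventually_gt_atTop 0] with t hI0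
    split_ifs with hF
    · exact hF.trans (Real.exp_pos _).le
    · push Not at hF
      refine (Real.le_exp_log _).trans (Real.exp_le_exp.2 ?_)
      have h1 := le_max_right 0 (1 + 2 * Real.log (F t) / I t)
      set m := max 0 (1 + 2 * Real.log (F t) / I t)
      have h2 : 2 * Real.log (F t) / I t ≤ m - 1 := by linarith
      rw [div_le_iff₀ hI0] at h2
      linarith

/-- Accuracy is only possible if both error rates are non-negative; the dummy entry even forces
`ηz` to be positive. -/
lemma InitAccurate.pos {n d K : ℕ} {p : Params n d K} {ηz ησ : ℝ} {i : Fin n}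
    {w : InitOutput n d K i} (h : InitAccurate p ηz ησ i w) : 0 < ηz ∧ 0 ≤ ησ := by
  obtain ⟨π, h1, h2⟩ := h
  refine ⟨lt_of_lt_of_le ?_ h1, (clusterError_nonneg _ _).trans (h2 0)⟩
  have hi : i ∈ Finset.univ.filter fun j => withDummy i w.1 j ≠ some (π (p.z j)) := by
    simp [withDummy]
  have hc : 0 < (Finset.univ.filter fun j => withDummy i w.1 j ≠ some (π (p.z j))).card :=
    Finset.card_pos.2 ⟨i, hi⟩
  have hn : 0 < n := i.pos
  positivity

/-- Bounded expectation on an event of probability at least `1 / 2` bounds the conditional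
expectation. -/
lemma integral_cond_le {Ω : Type*} [MeasurableSpace Ω] {μ : Measure Ω} [IsProbabilityMeasure μ]
    {G : Set Ω} {f : Ω → ℝ} (hf : 0 ≤ f) (hG : 1 / 2 ≤ μ.real G) :
    ∫ ω, f ω ∂(ProbabilityTheory.cond μ G) ≤ 2 * ∫ ω in G, f ω ∂μ := by
  rw [ProbabilityTheory.cond, integral_smul_measure, ENNReal.toReal_inv, smul_eq_mul]
  have h0 : 0 ≤ ∫ ω in G, f ω ∂μ := integral_nonneg hf
  have h1 : (μ G).toReal⁻¹ ≤ 2 := by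
    have := inv_anti₀ (by norm_num) hG
    simpa [measureReal_def] using this
  gcongr

/-- Markov's inequality, for the complementary event. -/
lemma one_sub_div_le_measureReal {Ω : Type*} [MeasurableSpace Ω] {ν : Measure Ω}
    [IsProbabilityMeasure ν] {f : Ω → ℝ} (hf : 0 ≤ f) (hint : Integrable f ν) {r : ℝ}
    (hr : 0 < r) : 1 - (∫ ω, f ω ∂ν) / r ≤ ν.real {ω | f ω ≤ r} := by
  have h1 := mul_meas_ge_le_integral_of_nonneg (ae_of_all _ hf) hint r
  have h2 : (1 : ℝ) ≤ ν.real {ω | f ω ≤ r} + ν.real {ω | r ≤ f ω} := by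
    have hu : {ω | f ω ≤ r} ∪ {ω | r ≤ f ω} = Set.univ := by
      ext ω
      simp [le_total]
    rw [← probReal_univ (μ := ν), ← hu]
    exact measureReal_union_le _ _
  have h3 : ν.real {ω | r ≤ f ω} ≤ (∫ ω, f ω ∂ν) / r := by
    rw [le_div_iff₀ hr]
    linarith
  linarith

lemma tendsto_max_rpow_neg_two {n d : ℕ → ℕ} (hn : Tendsto n atTop atTop) :
    Tendsto (fun t => ((max (n t) (d t) : ℕ) : ℝ) ^ (-2 : ℝ)) atTop (𝓝 0) := by
  have h : Tendsto (fun t => ((max (n t) (d t) : ℕ) : ℝ)) atTop atTop :=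
    tendsto_natCast_atTop_atTop.comp
      (tendsto_atTop_mono (fun t => le_max_left (n t) (d t)) hn)
  exact (tendsto_rpow_neg_atTop (by norm_num : (0 : ℝ) < 2)).comp h

end MMPBM

theorem theorem5
    -- the asymptotic regime: everything is indexed by `t → ∞`
    (n d K : ℕ → ℕ) (hn : Tendsto n atTop atTop) (hd : Tendsto d atTop atTop)
    (α β γ : ℝ) (hα : 1 ≤ α) (hβ : 1 ≤ β) (hγ : 1 ≤ γ)
    (θ₀ : ℕ → ℝ) (hθ₀ : ∀ t, 0 < θ₀ t)
    (p : ∀ t, MMPBM.Params (n t) (d t) (K t))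
    (hp : ∀ t, (p t).InSpace (θ₀ t) α β γ)
    -- the data and the seed of the initialization algorithm
    (Ω S : ℕ → Type*) [∀ t, MeasurableSpace (Ω t)] [∀ t, MeasurableSpace (S t)]
    (μ : ∀ t, Measure (Ω t)) [∀ t, IsProbabilityMeasure (μ t)]
    (X : ∀ t, Ω t → Fin (n t) → MMPBM.Network (d t))
    (hX : ∀ t, MMPBM.IsMMPBM (p t) (X t) (μ t))
    (U : ∀ t, Ω t → S t) (hU : ∀ t, Measurable (U t))
    (hUX : ∀ t, IndepFun (U t) (X t) (μ t))
    -- the initialization algorithm and its accuracy event `G t`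
    (A : ∀ t, MMPBM.InitAlgorithm (S t) (n t) (d t) (K t))
    (hA : ∀ t i, Measurable (Function.uncurry (A t i)))
    (ηz ησ : ℕ → ℝ) (C₁ : ℝ)
    (G : ∀ t, Set (Ω t))
    (hG : ∀ t, G t = {ω | ∀ i,
      MMPBM.InitAccurate (p t) (ηz t) (ησ t) i ((A t).run (U t ω) (X t ω) i)})
    (hGprob : ∀ t, 1 - C₁ * ((max (n t) (d t) : ℕ) : ℝ) ^ (-2 : ℝ) ≤ (μ t).real (G t))
    -- the output of the two-stage algorithm
    (zhat : ∀ t, Ω t → Fin (n t) → Fin 2) (hzhat : ∀ t, Measurable (zhat t))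
    (hout : ∀ t ω, MMPBM.IsTwoStageOutput (X t ω) ((A t).run (U t ω) (X t ω)) (zhat t ω))
    -- the conditions of the theorem
    (hησ : (fun t => ησ t * Real.log (1 / ησ t)) =o[atTop] fun t =>
      (p t).signal ^ 2 / ((K t : ℝ) ^ 2 * (d t : ℝ) ^ 2 * θ₀ t * ((d t : ℝ) / n t)))
    (hη : (fun t => max (ησ t) (ηz t)) =o[atTop] fun t =>
      (p t).signal / ((K t : ℝ) ^ 2 * (d t : ℝ) ^ 2 * θ₀ t))
    (C₀ : ℝ) (hC₀ : 0 < C₀) (ha : ∀ t, C₀ ≤ ((min (n t) (d t) : ℕ) : ℝ) * d t * θ₀ t)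
    (hK : (fun t => (K t : ℝ) ^ 2 * Real.log (n t)) =o[atTop] fun t => (n t : ℝ))
    (hI : Tendsto (fun t => (p t).signal) atTop atTop) :
    -- conditionally on `G t`, with high probability
    (∀ ε : ℝ, 0 < ε → ε < 1 → ∃ δ : ℕ → ℝ, Tendsto δ atTop (𝓝 0) ∧ ∀ᶠ t in atTop,
      1 - Real.exp (-((p t).signal ^ (1 - ε))) ≤
        (ProbabilityTheory.cond (μ t) (G t)).real
          {ω | MMPBM.clusterError (zhat t ω) (p t).z ≤
            Real.exp (-((1 - δ t) * ((p t).signal / 2)))}) ∧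
    -- conditionally on `G t`, in expectation, with an arbitrarily large exponent `C'`
    (∀ C' : ℝ, 0 < C' → ∃ δ : ℕ → ℝ, Tendsto δ atTop (𝓝 0) ∧ ∃ C : ℝ, ∀ᶠ t in atTop,
      ∫ ω, MMPBM.clusterError (zhat t ω) (p t).z ∂(ProbabilityTheory.cond (μ t) (G t)) ≤
        Real.exp (-((1 - δ t) * ((p t).signal / 2))) + C * (n t : ℝ) ^ (-C')) ∧
    -- unconditionally, in expectation, with the exponent `2` of the failure probability of `G t`
    (∃ δ : ℕ → ℝ, Tendsto δ atTop (𝓝 0) ∧ ∃ C : ℝ, ∀ᶠ t in atTop,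
      ∫ ω, MMPBM.clusterError (zhat t ω) (p t).z ∂(μ t) ≤
        Real.exp (-((1 - δ t) * ((p t).signal / 2))) + C * (n t : ℝ) ^ (-2 : ℝ)) := by
  have hIpos := hI.eventually_gt_atTop 0
  have hGhalf : ∀ᶠ t in atTop, 1 / 2 ≤ (μ t).real (G t) := by
    have h := (MMPBM.tendsto_max_rpow_neg_two (d := d) hn).const_mul C₁
    rw [mul_zero] at h
    filter_upwards [h.eventually (eventually_le_nhds (by norm_num : (0 : ℝ) < 1 / 2))] with t ht
    linarith [hGprob t]
  have hGmeas : ∀ t, MeasurableSet (G t) := fun t => by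
    rw [hG t]
    exact MMPBM.measurableSet_initAccurate (hA t) (hU t) (hX t).meas _ _
  -- the assumptions hold with any constant in place of the `o(1)` factors
  have hregime : ∀ c : ℝ, 0 < c → ∀ᶠ t in atTop,
      MMPBM.Regime c (n t) (d t) (K t) (θ₀ t) (p t).signal (ησ t) (ηz t) := by
    intro c hc
    have hlog : ∀ᶠ t in atTop, 1 ≤ Real.log (n t) :=
      (Real.tendsto_log_atTop.comp (tendsto_natCast_atTop_atTop.comp hn)).eventually_ge_atTop 1
    filter_upwards [hGhalf, hlog, hn.eventually_gt_atTop 0, hd.eventually_gt_atTop 0,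
      hI.eventually_ge_atTop 1, hησ.def hc, hη.def hc, hK.def hc] with t h1 h2 h3 h4 h5 h6 h7 h8
    have hθ := hθ₀ t
    have hne : (G t).Nonempty := by
      by_contra hempty
      rw [Set.not_nonempty_iff_eq_empty] at hempty
      rw [hempty, measureReal_empty] at h1
      linarith
    obtain ⟨ω, hω⟩ := hne
    rw [hG t] at hω
    have hpos := (hω ⟨0, h3⟩).pos
    rw [Real.norm_of_nonneg (r := (n t : ℝ)) (by positivity)] at h8
    rw [Real.norm_of_nonneg (r := (p t).signal ^ 2 / _) (by positivity)] at h6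
    rw [Real.norm_of_nonneg (r := (p t).signal / _) (by positivity)] at h7
    exact ⟨h4, ((p t).σ 0 ⟨0, h4⟩).pos, hθ, hpos.2, hpos.1, h5, h2, (Real.le_norm_self _).trans h6,
      (Real.le_norm_self _).trans h7, (Real.le_norm_self _).trans h8⟩
  have hset : ∀ ε : ℝ, 0 < ε → ε ≤ 1 → ∀ᶠ t in atTop,
      ∫ ω in G t, MMPBM.clusterError (zhat t ω) (p t).z ∂(μ t) ≤
        Real.exp (-((1 - ε) * ((p t).signal / 2))) := by
    intro ε hε hε1
    obtain ⟨c, hc, hmain⟩ := MMPBM.exists_setIntegral_clusterError_le hα hβ hγ hε hε1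
    filter_upwards [hregime c hc, hI.eventually_ge_atTop (1 / c)] with t h1 h2
    rw [hG t]
    exact hmain (hp t) h1 h2 (hX t) (hU t) (hUX t) (hA t) (hzhat t) (hout t)
  have hcond : ∀ ε : ℝ, 0 < ε → ε ≤ 1 → ∀ᶠ t in atTop,
      ∫ ω, MMPBM.clusterError (zhat t ω) (p t).z ∂(ProbabilityTheory.cond (μ t) (G t)) ≤
        Real.exp (-((1 - ε) * ((p t).signal / 2))) := by
    intro ε hε hε1
    filter_upwards [hset (ε / 2) (by positivity) (by linarith), hGhalf,
      hI.eventually_ge_atTop (4 / ε)] with t h1 h2 h3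
    refine (MMPBM.integral_cond_le (fun ω => MMPBM.clusterError_nonneg _ _) h2).trans ?_
    rw [div_le_iff₀ hε] at h3
    calc _ ≤ Real.exp 1 * Real.exp (-((1 - ε / 2) * ((p t).signal / 2))) := by
          have he1 : (2 : ℝ) ≤ Real.exp 1 := by linarith [Real.add_one_le_exp (1 : ℝ)]
          gcongr
          exact integral_nonneg fun ω => MMPBM.clusterError_nonneg _ _
      _ ≤ _ := by
          rw [← Real.exp_add]
          refine Real.exp_le_exp.2 ?_
          linarith
  obtain ⟨δ, hδ, hδF⟩ := MMPBM.exists_rate hI hcond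
  refine ⟨fun ε hε hε1 => ?_, fun C' _ => ⟨δ, hδ, 0, ?_⟩, ?_⟩
  · -- Markov's inequality, at the price of increasing `δ` by `2 I ^ (-ε)`
    refine ⟨fun t => δ t + 2 * (p t).signal ^ (-ε), ?_, ?_⟩
    · have h := hδ.add (((tendsto_rpow_neg_atTop hε).comp hI).const_mul 2)
      simpa using h
    · filter_upwards [hδF, hIpos, hGhalf] with t h1 h2 h3
      have hG0 : μ t (G t) ≠ 0 := fun h0 => by
        rw [measureReal_def, h0, ENNReal.toReal_zero] at h3
        linarith
      have := ProbabilityTheory.cond_isProbabilityMeasure hG0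
      refine le_trans ?_ (MMPBM.one_sub_div_le_measureReal
        (fun ω => MMPBM.clusterError_nonneg _ _)
        (MMPBM.integrable_clusterError (hzhat t) (p t).z) (Real.exp_pos _))
      rw [sub_le_sub_iff_left, div_le_iff₀ (Real.exp_pos _), ← Real.exp_add]
      refine h1.trans (Real.exp_le_exp.2 ?_)
      have hpow : (p t).signal ^ (1 - ε) = (p t).signal * (p t).signal ^ (-ε) := by
        rw [sub_eq_add_neg, Real.rpow_add h2, Real.rpow_one]
      rw [hpow]
      exact le_of_eq (by ring)
  · simpa using hδF
  · obtain ⟨δ', hδ', hδF'⟩ := MMPBM.exists_rate hI hset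
    refine ⟨δ', hδ', |C₁|, ?_⟩
    filter_upwards [hδF', hn.eventually_gt_atTop 0] with t h1 h2
    have hint := MMPBM.integrable_clusterError (ν := μ t) (hzhat t) (p t).z
    rw [← integral_add_compl (hGmeas t) hint]
    refine add_le_add h1 ?_
    calc ∫ ω in (G t)ᶜ, MMPBM.clusterError (zhat t ω) (p t).z ∂(μ t)
        ≤ ∫ _ω in (G t)ᶜ, (1 : ℝ) ∂(μ t) :=
          integral_mono hint.integrableOn (integrable_const _)
            fun ω => MMPBM.clusterError_le_one _ _
      _ = 1 - (μ t).real (G t) := by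
          rw [setIntegral_const, smul_eq_mul, mul_one, probReal_compl_eq_one_sub (hGmeas t)]
      _ ≤ C₁ * ((max (n t) (d t) : ℕ) : ℝ) ^ (-2 : ℝ) := by linarith [hGprob t]
      _ ≤ |C₁| * (n t : ℝ) ^ (-2 : ℝ) := by
          have hn0 : (0 : ℝ) < n t := by exact_mod_cast h2
          have hmax : (n t : ℝ) ≤ ((max (n t) (d t) : ℕ) : ℝ) := by
            exact_mod_cast le_max_left _ _
          have hp2 := Real.rpow_le_rpow_of_nonpos hn0 hmax (by norm_num : (-2 : ℝ) ≤ 0)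
          gcongr
          exact le_abs_self _
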